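/- All graphs are simple, with finite nonempty vertex set. Let $n\ge 1$ and let $d=(d_1,\dots,d_n)$, with $d_1\ge\dots\ge d_n$, be the degree sequence of a graph. A realization of $d$ is a graph with vertex set $\{1,\dots,n\}$ in which vertex $i$ has degree $d_i$ for every $i$. If $a,b,c,e$ are four distinct vertices of a graph $G$ such that $ab,ce$ are edges and $ae,bc$ are not, then $a,b,c,e$ form an alternating $4$-cycle of $G$, and the operation of deleting the edges $ab,ce$ and adding the edges $ae,bc$ is a $2$-switch in $G$. The realization graph $\mathscr{G}(d)$ has the realizations of $d$ as its vertices, two of them being adjacent if and only if some $2$-switch changes one into the other. For $k\ge1$, the transposition graph $T_k$ has the permutations of $\{1,\dots,k\}$ as its vertices, two being adjacent if and only if they differ by exactly one transposition. $K_{6,6}-6K_2$ is the complete bipartite graph $K_{6,6}$ minus the edges of a perfect matching. A graph $G$ is pseudo-split if its vertex set is the union of disjoint, possibly empty sets $V_1,V_2,V_3$ such that $V_1$ is independent, $V_2$ is a clique, no vertex of $V_1$ has a neighbor in $V_3$, every vertex of $V_2$ is adjacent to every vertex of $V_3$, and either $V_3$ is empty or the induced subgraph $G[V_3]$ is isomorphic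 to the cycle $C_5$. A graph $G$ is matrogenic if the vertex sets of its alternating $4$-cycles are the circuits of a matroid with ground set $V(G)$. Then the following are equivalent: (a) $\mathscr{G}(d)$ is bipartite; (b) $\mathscr{G}(d)$ is triangle-free; (c) $\mathscr{G}(d)$ is isomorphic to a Cartesian product of finitely many (possibly zero) transposition graphs $T_{k}$, $k\ge1$, and at most one copy of $K_{6,6}-6K_2$ (the empty product being $K_1$); (d) $d$ is the degree sequence of a pseudo-split matrogenic graph, that is, some realization of $d$ is pseudo-split and matrogenic. -/

import Mathlib

namespace SimpleGraph

variable {V : Type*}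

/-- `a, b, c, e` are four distinct vertices, `ab` and `ce` are edges of `G`, and `bc` and `ae` are
not: the four vertices form, in this cyclic order, an alternating 4-cycle of `G`. This is exactly
the condition under which the 2-switch `{ab, ce} ⇉ {ae, bc}` can be performed. -/
structure IsAlternatingFourCycle (G : SimpleGraph V) (a b c e : V) : Prop where
  ne_ab : a ≠ b
  ne_ac : a ≠ c
  ne_ae : a ≠ e
  ne_bc : b ≠ c
  ne_be : b ≠ e
  ne_ce : c ≠ e
  adj_ab : G.Adj a b
  adj_ce : G.Adj c e
  not_adj_ae : ¬ G.Adj a e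
  not_adj_bc : ¬ G.Adj b c

/-- The result of deleting the edges `ab`, `ce` from `G` and adding the edges `ae`, `bc`. -/
def twoSwitch (G : SimpleGraph V) (a b c e : V) : SimpleGraph V :=
  fromEdgeSet ((G.edgeSet \ {s(a, b), s(c, e)}) ∪ {s(a, e), s(b, c)})

/-- Performing some 2-switch changes `G` into `G'`. -/
def TwoSwitchRel (G G' : SimpleGraph V) : Prop :=
  ∃ a b c e : V, G.IsAlternatingFourCycle a b c e ∧ G' = G.twoSwitch a b c e

theorem TwoSwitchRel.symm {G G' : SimpleGraph V} (h : TwoSwitchRel G G') : TwoSwitchRel G' G := by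
  obtain ⟨a, b, c, e, h, rfl⟩ := h
  obtain ⟨hab, hac, hae, hbc, hbe, hce, h1, h2, h3, h4⟩ := h
  have h3' : ¬ G.Adj e a := fun h => h3 h.symm
  have h4' : ¬ G.Adj c b := fun h => h4 h.symm
  refine ⟨a, e, c, b, ⟨hae, hac, hab, hce.symm, hbe.symm, hbc.symm, ?_, ?_, ?_, ?_⟩, ?_⟩
  · simp [twoSwitch, hae]
  · simp [twoSwitch, hbc.symm]
  · simp [twoSwitch]; grind
  · simp [twoSwitch]; grind
  · ext x y
    have h5 : G.Adj x y → x ≠ y := fun h => h.ne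
    have h6 := G.adj_comm x y
    simp [twoSwitch]
    grind

theorem not_twoSwitchRel_self (G : SimpleGraph V) : ¬ TwoSwitchRel G G := by
  rintro ⟨a, b, c, e, h, h'⟩
  apply h.not_adj_ae
  rw [h']
  simp [twoSwitch, h.ne_ae]

/-- `G` is a realization of `d = (d 0, …, d (n - 1))`: vertex `i` has degree `d i`. -/
def IsRealization {n : ℕ} (d : Fin n → ℕ) (G : SimpleGraph (Fin n)) : Prop :=
  ∀ i, (G.neighborSet i).ncard = d i

/-- The 2-switch realization graph of `d`. -/
def realizationGraph {n : ℕ} (d : Fin n → ℕ) :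
    SimpleGraph {G : SimpleGraph (Fin n) // IsRealization d G} where
  Adj G G' := TwoSwitchRel G.1 G'.1
  symm := ⟨fun _ _ h => h.symm⟩
  loopless := ⟨fun G => not_twoSwitchRel_self G.1⟩

/-- The transposition graph `T_k`: its vertices are the permutations of a `k`-element set, two of
them being adjacent when they differ by exactly one transposition. -/
def transpositionGraph (k : ℕ) : SimpleGraph (Equiv.Perm (Fin k)) where
  Adj σ τ := (σ⁻¹ * τ).IsSwap
  symm := ⟨by
    rintro σ τ ⟨x, y, hxy, h⟩
    refine ⟨x, y, hxy, ?_⟩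
    have h' : τ⁻¹ * σ = (σ⁻¹ * τ)⁻¹ := by group
    rw [h', h, Equiv.swap_inv]⟩
  loopless := ⟨by
    rintro σ ⟨x, y, hxy, h⟩
    rw [inv_mul_cancel] at h
    exact hxy (Equiv.swap_eq_one_iff.mp h.symm)⟩

/-- The Cartesian product of a family of graphs: two vertices are adjacent when they differ in
exactly one coordinate, and their entries there are adjacent. (The empty product is `K_1`.) -/
def boxProdPi {ι : Type*} {W : ι → Type*} (G : ∀ i, SimpleGraph (W i)) :
    SimpleGraph (∀ i, W i) where
  Adj x y := ∃ i, (G i).Adj (x i) (y i) ∧ ∀ j, j ≠ i → x j = y j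
  symm := ⟨fun _ _ ⟨i, h, h'⟩ => ⟨i, h.symm, fun j hj => (h' j hj).symm⟩⟩
  loopless := ⟨fun _ ⟨_, h, _⟩ => h.ne rfl⟩

/-- `K_{6,6} - 6K_2`: the complete bipartite graph `K_{6,6}` minus a perfect matching. -/
def completeBipartiteSixMinusMatching : SimpleGraph (Fin 6 ⊕ Fin 6) :=
  (completeBipartiteGraph (Fin 6) (Fin 6)).deleteEdges
    {e | ∃ i : Fin 6, e = s(Sum.inl i, Sum.inr i)}

/-- A pseudo-split graph: `V₁` is independent, `V₂` is a clique, there is no edge between `V₁` and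
`V₃`, every possible edge between `V₂` and `V₃`, and `V₃` is empty or induces a 5-cycle. -/
def IsPseudoSplit (G : SimpleGraph V) : Prop :=
  ∃ V₁ V₂ V₃ : Set V,
    Disjoint V₁ V₂ ∧ Disjoint V₁ V₃ ∧ Disjoint V₂ V₃ ∧ V₁ ∪ V₂ ∪ V₃ = Set.univ ∧
    G.IsIndepSet V₁ ∧ G.IsClique V₂ ∧
    (∀ x ∈ V₁, ∀ y ∈ V₃, ¬ G.Adj x y) ∧ (∀ x ∈ V₂, ∀ y ∈ V₃, G.Adj x y) ∧
    (V₃ = ∅ ∨ Nonempty (G.induce V₃ ≃g cycleGraph 5))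

/-- A matrogenic graph: the vertex sets of the alternating 4-cycles are the circuits of a matroid
with ground set the whole vertex set. -/
def IsMatrogenic (G : SimpleGraph V) : Prop :=
  ∃ M : Matroid V, M.E = Set.univ ∧
    ∀ C : Set V, M.IsCircuit C ↔ ∃ a b c e : V, G.IsAlternatingFourCycle a b c e ∧ C = {a, b, c, e}

end SimpleGraph

namespace SimpleGraph

/-! ### 2-switches, and triangles in the realization graph -/

section TwoSwitch

variable {V : Type*}

/-! The pivot is `IsSwitchTame`. If it fails for a realization, two of its 2-switches lead to graphs
that are again one 2-switch apart (`isSwitchTame_of_cliqueFree`). So (b) makes every realization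
tame.

In a tame graph a vertex of larger degree dominates a vertex of smaller degree, and adjacency
between degree classes is monotone. This produces an integer weight `w` such that a positive sum `w
x + w y` forces adjacency of distinct vertices and a negative sum forbids it
(`IsSwitchTame.exists_weight`). Only pairs of opposite weights stay undecided, and there private
neighbors exist and are unique (`IsTightWeight.existsUnique_private`). Hence the level `w = 0` is a
5-cycle or has at most one vertex, and a level `|w| = t > 0` with an undecided pair is a clique and
an independent set joined by a perfect matching or the complement of one
(`IsTightWeight.level_zero`, `IsTightWeight.level_pos`). The pseudo-split partition is read off the
sign of `w`, and circuit elimination is checked level by level; this gives (d). Conversely, (d)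
implies tameness (`IsPseudoSplit.diagonal`, `IsMatrogenic.private_unique`).

For (c), all realizations agree on the decided pairs (`IsThresholdWeight.adj_iff_of_ncard_eq`), and
the four vertices of a 2-switch lie on one level, so the realization graph is the Cartesian product
of those of the levels. On a matching level the realizations are permutations and 2-switches are
transpositions, which gives `T_k`; the twelve labelled 5-cycles give `K_{6,6} - 6K_2`; a level
without undecided pairs is rigid and gives `T_1`. All these factors have sign colorings, whose
products color the Cartesian product; this gives (a). -/

theorem IsAlternatingFourCycle.twoSwitch_adj {G : SimpleGraph V} {a b c e : V}
    (h : G.IsAlternatingFourCycle a b c e) (x y : V) :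
    (G.twoSwitch a b c e).Adj x y ↔
      (G.Adj x y ∧ s(x, y) ≠ s(a, b) ∧ s(x, y) ≠ s(c, e)) ∨
        s(x, y) = s(a, e) ∨ s(x, y) = s(b, c) := by
  obtain ⟨hab, hac, hae, hbc, hbe, hce, h1, h2, h3, h4⟩ := h
  have h5 : G.Adj x y → x ≠ y := fun h => h.ne
  simp [twoSwitch]
  grind

theorem IsAlternatingFourCycle.rotate {G : SimpleGraph V} {a b c e : V}
    (h : G.IsAlternatingFourCycle a b c e) : G.IsAlternatingFourCycle b a e c := by
  obtain ⟨hab, hac, hae, hbc, hbe, hce, h1, h2, h3, h4⟩ := h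
  exact ⟨hab.symm, hbe, hbc, hae, hac, hce.symm, h1.symm, h2.symm, h4, h3⟩

theorem IsAlternatingFourCycle.twoSwitch_rotate {G : SimpleGraph V} {a b c e : V}
    (h : G.IsAlternatingFourCycle a b c e) : G.twoSwitch a b c e = G.twoSwitch b a e c := by
  ext x y
  rw [h.twoSwitch_adj, h.rotate.twoSwitch_adj]
  grind

theorem IsAlternatingFourCycle.of_adj {G : SimpleGraph V} {a b c e : V}
    (h1 : G.Adj a b) (h2 : G.Adj c e) (h3 : ¬ G.Adj a e) (h4 : ¬ G.Adj b c)
    (hae : a ≠ e) (hbc : b ≠ c) : G.IsAlternatingFourCycle a b c e :=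
  ⟨h1.ne, by rintro rfl; exact h3 h2, hae, hbc, by rintro rfl; exact h3 h1, h2.ne, h1, h2, h3, h4⟩

theorem IsAlternatingFourCycle.ncard_neighborSet_twoSwitch [Finite V] {G : SimpleGraph V}
    {a b c e : V} (h : G.IsAlternatingFourCycle a b c e) (x : V) :
    ((G.twoSwitch a b c e).neighborSet x).ncard = (G.neighborSet x).ncard := by
  have key : ∀ {a b c e : V}, G.IsAlternatingFourCycle a b c e →
      ((G.twoSwitch a b c e).neighborSet a).ncard = (G.neighborSet a).ncard := by
    intro a b c e h
    rw [← Set.ncard_exchange (s := G.neighborSet a) (a := e) (b := b)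
      (by simpa using h.not_adj_ae) (by simpa using h.adj_ab)]
    congr 1
    ext y
    obtain ⟨hab, hac, hae, hbc, hbe, hce, -⟩ := id h
    simp [h.twoSwitch_adj]
    grind
  have e1 := h.twoSwitch_rotate
  have h' : G.IsAlternatingFourCycle c e a b := by
    obtain ⟨hab, hac, hae, hbc, hbe, hce, h1, h2, h3, h4⟩ := h
    exact ⟨hce, hac.symm, hbc.symm, hae.symm, hbe.symm, hab, h2, h1, fun h => h4 h.symm,
      fun h => h3 h.symm⟩
  have e2 : G.twoSwitch a b c e = G.twoSwitch c e a b := by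
    ext x y; rw [h.twoSwitch_adj, h'.twoSwitch_adj]; grind
  have e3 : G.twoSwitch a b c e = G.twoSwitch e c b a := e2.trans h'.twoSwitch_rotate
  by_cases xa : x = a
  · subst xa; exact key h
  by_cases xb : x = b
  · subst xb; rw [e1]; exact key h.rotate
  by_cases xc : x = c
  · subst xc; rw [e2]; exact key h'
  by_cases xe : x = e
  · subst xe; rw [e3]; exact key h'.rotate
  congr 1
  ext y
  simp only [mem_neighborSet, h.twoSwitch_adj]
  grind

/-- The realization graph of the degree function `d` on an arbitrary vertex type. -/
def degreeRealizationGraph (d : V → ℕ) :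
    SimpleGraph {G : SimpleGraph V // ∀ v, (G.neighborSet v).ncard = d v} where
  Adj G G' := TwoSwitchRel G.1 G'.1
  symm := ⟨fun _ _ h => h.symm⟩
  loopless := ⟨fun G => not_twoSwitchRel_self G.1⟩

/-- Incomparable vertices have a single private neighbor each, and the four vertices of an
alternating 4-cycle do not induce `2K₂` or `C₄`. -/
structure IsSwitchTame (G : SimpleGraph V) : Prop where
  private_unique : ∀ ⦃u v x y z : V⦄, G.Adj u x → ¬ G.Adj v x → x ≠ v →
    G.Adj v y → ¬ G.Adj u y → y ≠ u → G.Adj v z → ¬ G.Adj u z → z ≠ u → y = z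
  diagonal : ∀ ⦃a b c e : V⦄, G.IsAlternatingFourCycle a b c e → (G.Adj a c ↔ ¬ G.Adj b e)

/-- Switching `ux` against `vy` or against `vz` gives two realizations that differ by switching `uy`
against `vz`. If the four vertices induce `2K₂` or `C₄`, the three perfect matchings on them give
three realizations. Both times a triangle appears. -/
theorem isSwitchTame_of_cliqueFree [Finite V] {d : V → ℕ}
    (hd : (degreeRealizationGraph d).CliqueFree 3) {G : SimpleGraph V}
    (hG : ∀ v, (G.neighborSet v).ncard = d v) : G.IsSwitchTame := by
  classical
  have key : ∀ {a b c e a' b' c' e' p q r s : V}, G.IsAlternatingFourCycle a b c e →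
      G.IsAlternatingFourCycle a' b' c' e' →
      (G.twoSwitch a b c e).IsAlternatingFourCycle p q r s →
      G.twoSwitch a' b' c' e' = (G.twoSwitch a b c e).twoSwitch p q r s → False := by
    intro a b c e a' b' c' e' p q r s h1 h2 h3 h4
    let G₁ : {G : SimpleGraph V // ∀ v, (G.neighborSet v).ncard = d v} := ⟨G, hG⟩
    let G₂ : {G : SimpleGraph V // ∀ v, (G.neighborSet v).ncard = d v} :=
      ⟨_, fun v => (h1.ncard_neighborSet_twoSwitch v).trans (hG v)⟩
    let G₃ : {G : SimpleGraph V // ∀ v, (G.neighborSet v).ncard = d v} :=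
      ⟨_, fun v => (h2.ncard_neighborSet_twoSwitch v).trans (hG v)⟩
    apply hd {G₁, G₂, G₃}
    rw [is3Clique_triple_iff]
    exact ⟨⟨a, b, c, e, h1, rfl⟩, ⟨a', b', c', e', h2, rfl⟩, ⟨p, q, r, s, h3, h4⟩⟩
  constructor
  · intro u v x y z hux hvx xv hvy huy yu hvz huz zu
    by_contra hyz
    have h1 := IsAlternatingFourCycle.of_adj hux hvy huy (fun h => hvx h.symm) yu.symm xv
    have h2 := IsAlternatingFourCycle.of_adj hux hvz huz (fun h => hvx h.symm) zu.symm xv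
    have uv := h1.ne_ac
    have vz := hvz.ne
    have vy := hvy.ne
    have ux := hux.ne
    have xz := h2.ne_be
    have xy := h1.ne_be
    have h3 : (G.twoSwitch u x v y).IsAlternatingFourCycle u y v z := by
      refine IsAlternatingFourCycle.of_adj ?_ ?_ ?_ ?_ zu.symm hvy.ne.symm <;>
        rw [h1.twoSwitch_adj] <;> simp <;> grind
    refine key h1 h2 h3 ?_
    ext i j
    rw [h2.twoSwitch_adj, h3.twoSwitch_adj, h1.twoSwitch_adj]
    have h5 := G.adj_comm i j
    clear key h1 h2 h3 hG hd
    simp only [Sym2.eq_iff, ne_eq]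
    grind [SimpleGraph.adj_comm]
  · intro a b c e h
    obtain ⟨hab, hac, hae, hbc, hbe, hce, h1, h2, h3, h4⟩ := id h
    by_contra hcon
    by_cases hx : G.Adj a c
    · have hy : G.Adj b e := by tauto
      have h' : G.IsAlternatingFourCycle a c b e :=
        IsAlternatingFourCycle.of_adj hx hy h3 (fun h => h4 h.symm) hae hbc.symm
      have h'' : (G.twoSwitch a b c e).IsAlternatingFourCycle a c e b := by
        refine IsAlternatingFourCycle.of_adj ?_ ?_ ?_ ?_ hab hce <;>
          rw [h.twoSwitch_adj] <;> simp <;> grind [SimpleGraph.adj_comm]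
      refine key h h' h'' ?_
      ext i j
      rw [h'.twoSwitch_adj, h''.twoSwitch_adj, h.twoSwitch_adj]
      clear key h h' h'' hG hd
      simp only [Sym2.eq_iff, ne_eq]
      grind [SimpleGraph.adj_comm]
    · have hy : ¬ G.Adj b e := by tauto
      have h' : G.IsAlternatingFourCycle b a c e :=
        IsAlternatingFourCycle.of_adj h1.symm h2 hy hx hbe hac
      have h'' : (G.twoSwitch a b c e).IsAlternatingFourCycle a e b c := by
        refine IsAlternatingFourCycle.of_adj ?_ ?_ ?_ ?_ hac hbe.symm <;>
          rw [h.twoSwitch_adj] <;> simp <;> grind [SimpleGraph.adj_comm]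
      refine key h h' h'' ?_
      ext i j
      rw [h'.twoSwitch_adj, h''.twoSwitch_adj, h.twoSwitch_adj]
      clear key h h' h'' hG hd
      simp only [Sym2.eq_iff, ne_eq]
      grind [SimpleGraph.adj_comm]

end TwoSwitch

end SimpleGraph

namespace SimpleGraph

/-! ### Threshold weights and the pairs they decide -/

section Threshold

variable {V : Type*}

/-- The sign of `w x + w y`, if nonzero, decides whether the distinct vertices `x` and `y` are
adjacent. -/
structure IsThresholdWeight (G : SimpleGraph V) (w : V → ℤ) : Prop where
  adj : ∀ ⦃x y⦄, x ≠ y → 0 < w x + w y → G.Adj x y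
  not_adj : ∀ ⦃x y⦄, w x + w y < 0 → ¬ G.Adj x y

/-- The two edges and the two nonedges have the same total weight, at least 0 for the edges and at
most 0 for the nonedges. So all four sums vanish. -/
theorem IsThresholdWeight.level {G : SimpleGraph V} {w : V → ℤ} (hw : G.IsThresholdWeight w)
    {a b c e : V} (h : G.IsAlternatingFourCycle a b c e) :
    w b = - w a ∧ w c = w a ∧ w e = - w a := by
  have h1 : 0 ≤ w a + w b := by by_contra! h'; exact hw.not_adj h' h.adj_ab
  have h2 : 0 ≤ w c + w e := by by_contra! h'; exact hw.not_adj h' h.adj_ce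
  have h3 : w a + w e ≤ 0 := by by_contra! h'; exact h.not_adj_ae (hw.adj h.ne_ae h')
  have h4 : w b + w c ≤ 0 := by by_contra! h'; exact h.not_adj_bc (hw.adj h.ne_bc h')
  omega

theorem IsThresholdWeight.exists_twoSwitch_nonneg {G G' : SimpleGraph V} {w : V → ℤ}
    (hw : G.IsThresholdWeight w) (h : TwoSwitchRel G G') :
    ∃ a b c e, 0 ≤ w a ∧ G.IsAlternatingFourCycle a b c e ∧ G' = G.twoSwitch a b c e := by
  obtain ⟨a, b, c, e, h, rfl⟩ := h
  by_cases ha : 0 ≤ w a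
  · exact ⟨a, b, c, e, ha, h, rfl⟩
  · have := hw.level h
    exact ⟨b, a, e, c, by omega, h.rotate, h.twoSwitch_rotate⟩

open Classical in
/-- All graphs with the same degrees agree on the pairs decided by a threshold weight of one of
them. -/
theorem IsThresholdWeight.adj_iff_of_ncard_eq [Finite V] {G H : SimpleGraph V} {w : V → ℤ}
    (hw : G.IsThresholdWeight w)
    (hd : ∀ v, (H.neighborSet v).ncard = (G.neighborSet v).ncard) {x y : V}
    (hxy : w x + w y ≠ 0) : H.Adj x y ↔ G.Adj x y := by
  have := Fintype.ofFinite V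
  -- The total weight of the edges depends on the degrees only. Comparing `G` with `H`, every
  -- summand is nonnegative because `G` follows the sign of `w x + w y`, so every summand is 0.
  have hsum : ∀ K : SimpleGraph V, ∑ x, ∑ y, (w x + w y) * (if K.Adj x y then 1 else 0) =
      2 * ∑ x, w x * (K.neighborSet x).ncard := by
    intro K
    have h1 : ∀ x, ∑ y, w x * (if K.Adj x y then 1 else 0) = w x * (K.neighborSet x).ncard := by
      intro x
      rw [← Finset.mul_sum]
      congr 1
      rw [Finset.sum_boole, Set.ncard_eq_toFinset_card']
      congr 2
      ext y; simp
    have h2 : ∑ x, ∑ y, w y * (if K.Adj x y then 1 else 0) =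
        ∑ x, ∑ y, w x * (if K.Adj x y then 1 else 0) := by
      rw [Finset.sum_comm]
      simp only [K.adj_comm]
    simp only [add_mul, Finset.sum_add_distrib, h2, h1]
    ring
  have h0 : ∑ x, ∑ y, (w x + w y) *
      ((if G.Adj x y then 1 else 0) - (if H.Adj x y then 1 else 0)) = 0 := by
    simp only [mul_sub, Finset.sum_sub_distrib, hsum, hd, sub_self]
  have hnn : ∀ x y, 0 ≤ (w x + w y) *
      ((if G.Adj x y then 1 else 0) - (if H.Adj x y then 1 else 0)) := by
    intro x y
    rcases lt_trichotomy (w x + w y) 0 with h | h | h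
    · rw [if_neg (hw.not_adj h)]
      split_ifs <;> omega
    · simp [h]
    · by_cases e : x = y
      · subst e; simp
      · rw [if_pos (hw.adj e h)]
        split_ifs <;> omega
  have h1 := (Finset.sum_eq_zero_iff_of_nonneg
    (fun x _ => Finset.sum_nonneg fun y _ => hnn x y)).1 h0 x (Finset.mem_univ x)
  have h2 := (Finset.sum_eq_zero_iff_of_nonneg (fun y _ => hnn x y)).1 h1 y (Finset.mem_univ y)
  have h3 := (mul_eq_zero.1 h2).resolve_left hxy
  by_cases hG : G.Adj x y <;> by_cases hH : H.Adj x y <;> simp_all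

end Threshold

/-! ### Adjacency between degree classes -/

section AdjSign

variable {V : Type*}

/-- Some vertex of the degree of `x` is adjacent to some vertex of degree at most that of `y`. -/
def HasEdgeBelow (G : SimpleGraph V) (x y : V) : Prop :=
  ∃ x' y', (G.neighborSet x').ncard = (G.neighborSet x).ncard ∧
    (G.neighborSet y').ncard ≤ (G.neighborSet y).ncard ∧ G.Adj x' y'

/-- Some vertex of the degree of `x` is not adjacent to some other vertex of degree at least that
of `y`. -/
def HasNonedgeAbove (G : SimpleGraph V) (x y : V) : Prop :=
  ∃ x' y', (G.neighborSet x').ncard = (G.neighborSet x).ncard ∧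
    (G.neighborSet y).ncard ≤ (G.neighborSet y').ncard ∧ x' ≠ y' ∧ ¬ G.Adj x' y'

open Classical in
/-- `1`, `-1` or `0` when the vertices of the degrees of `x` and `y` are always, never, or
sometimes adjacent. -/
noncomputable def adjSign (G : SimpleGraph V) (x y : V) : ℤ :=
  (if G.HasNonedgeAbove x y then 0 else 1) - (if G.HasEdgeBelow x y then 0 else 1)

theorem adjSign_le_one (G : SimpleGraph V) (x y : V) : G.adjSign x y ≤ 1 := by
  unfold adjSign; split_ifs <;> simp

theorem neg_one_le_adjSign (G : SimpleGraph V) (x y : V) : -1 ≤ G.adjSign x y := by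
  unfold adjSign; split_ifs <;> simp

end AdjSign

/-! ### Construction of the weight of a tame graph -/

section Tame

variable {V : Type*} [Finite V] {G : SimpleGraph V}

/-- If `v` has a private neighbor with respect to `u` and the degree of `v` is at most the
degree of `u`, then `u` has a private neighbor with respect to `v`. -/
theorem exists_private_of_ncard_le {u v x : V}
    (h : (G.neighborSet v).ncard ≤ (G.neighborSet u).ncard)
    (hv : G.Adj v x) (hu : ¬ G.Adj u x) (hx : x ≠ u) :
    ∃ y, G.Adj u y ∧ ¬ G.Adj v y ∧ y ≠ v := by
  by_contra! hcon
  have hsub : G.neighborSet u \ {v} ⊆ (G.neighborSet v \ {u}) \ {x} := by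
    rintro y ⟨hy, hyv⟩
    have : G.Adj v y := by by_contra h'; exact hyv (hcon y hy h')
    refine ⟨⟨this, ?_⟩, ?_⟩
    · rintro rfl; exact hy.ne rfl
    · rintro rfl; exact hu hy
  have h1 := Set.ncard_le_ncard hsub
  have h2 : ((G.neighborSet v \ {u}) \ {x}).ncard + 1 = (G.neighborSet v \ {u}).ncard :=
    Set.ncard_sdiff_singleton_add_one ⟨hv, hx⟩
  by_cases huv : G.Adj u v
  · have h3 := Set.ncard_sdiff_singleton_add_one (s := G.neighborSet u) huv
    have h4 := Set.ncard_sdiff_singleton_add_one (s := G.neighborSet v) huv.symm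
    omega
  · rw [Set.sdiff_singleton_eq_self (by simpa using huv)] at h1
    rw [Set.sdiff_singleton_eq_self (s := G.neighborSet v)
      (by simpa using fun h : G.Adj v u => huv h.symm)] at h1 h2
    omega

/-- With more neighbors, there are at least two private neighbors. -/
theorem IsSwitchTame.adj_of_ncard_lt (hG : G.IsSwitchTame) {u v x : V}
    (h : (G.neighborSet v).ncard < (G.neighborSet u).ncard)
    (hv : G.Adj v x) (hx : x ≠ u) : G.Adj u x := by
  by_contra hu
  obtain ⟨y, hy, hvy, hyv⟩ := exists_private_of_ncard_le h.le hv hu hx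
  have huniq : ∀ z, G.Adj u z → ¬ G.Adj v z → z ≠ v → z = y := fun z h1 h2 h3 =>
    hG.private_unique hv hu hx h1 h2 h3 hy hvy hyv
  have hsub : (G.neighborSet u \ {v}) \ {y} ⊆ (G.neighborSet v \ {u}) \ {x} := by
    rintro z ⟨⟨hz, hzv⟩, hzy⟩
    have : G.Adj v z := by by_contra h'; exact hzy (huniq z hz h' hzv)
    refine ⟨⟨this, ?_⟩, ?_⟩
    · rintro rfl; exact hz.ne rfl
    · rintro rfl; exact hu hz
  have h1 := Set.ncard_le_ncard hsub
  have h2 : ((G.neighborSet v \ {u}) \ {x}).ncard + 1 = (G.neighborSet v \ {u}).ncard :=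
    Set.ncard_sdiff_singleton_add_one ⟨hv, hx⟩
  have h2' : ((G.neighborSet u \ {v}) \ {y}).ncard + 1 = (G.neighborSet u \ {v}).ncard :=
    Set.ncard_sdiff_singleton_add_one ⟨hy, hyv⟩
  by_cases huv : G.Adj u v
  · have h3 := Set.ncard_sdiff_singleton_add_one (s := G.neighborSet u) huv
    have h4 := Set.ncard_sdiff_singleton_add_one (s := G.neighborSet v) huv.symm
    omega
  · rw [Set.sdiff_singleton_eq_self (s := G.neighborSet u) (by simpa using huv)] at h1 h2'
    rw [Set.sdiff_singleton_eq_self (s := G.neighborSet v)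
      (by simpa using fun h : G.Adj v u => huv h.symm)] at h1 h2
    omega

theorem IsSwitchTame.ncard_eq_of_private (hG : G.IsSwitchTame) {u v x y : V}
    (hux : G.Adj u x) (hvx : ¬ G.Adj v x) (hxv : x ≠ v)
    (hvy : G.Adj v y) (huy : ¬ G.Adj u y) (hyu : y ≠ u) :
    (G.neighborSet u).ncard = (G.neighborSet v).ncard := by
  rcases lt_trichotomy (G.neighborSet u).ncard (G.neighborSet v).ncard with h | h | h
  · exact absurd (hG.adj_of_ncard_lt h hux hxv) hvx
  · exact h
  · exact absurd (hG.adj_of_ncard_lt h hvy hyu) huy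

/-- By domination, `x` is adjacent to every other vertex of degree above that of `y`. If `x'` missed
`z`, it would have a private neighbor `t` against `x`; then `z` and `t` have private neighbors
against each other, so equal degrees, and `x` would be adjacent to `t` after all. -/
theorem IsSwitchTame.adj_of_adj_of_ncard_lt (hG : G.IsSwitchTame) {x y x' z : V}
    (hxy : G.Adj x y) (hyz : (G.neighborSet y).ncard < (G.neighborSet z).ncard)
    (hx : (G.neighborSet x').ncard = (G.neighborSet x).ncard) (hne : x' ≠ z) : G.Adj x' z := by
  have h1 : ∀ z', (G.neighborSet y).ncard < (G.neighborSet z').ncard → z' ≠ x → G.Adj x z' :=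
    fun z' h h' => (hG.adj_of_ncard_lt h hxy.symm h'.symm).symm
  by_cases hzx : z = x
  · subst hzx
    exact (h1 x' (hx ▸ hyz) hne).symm
  by_contra hcon
  have hxz := h1 z hyz hzx
  have hxx' : x ≠ x' := by rintro rfl; exact hcon hxz
  obtain ⟨t, ht, hxt, htx⟩ := exists_private_of_ncard_le hx.ge hxz hcon hne.symm
  have hzt := hG.ncard_eq_of_private hxz.symm (fun h => hxt h.symm) htx.symm ht.symm
    (fun h => hcon h.symm) hne
  exact hxt (h1 t (hzt ▸ hyz) htx)

theorem IsSwitchTame.not_hasNonedgeAbove (hG : G.IsSwitchTame) {x y z : V}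
    (h : G.HasEdgeBelow x y) (hyz : (G.neighborSet y).ncard < (G.neighborSet z).ncard) :
    ¬ G.HasNonedgeAbove x z := by
  rintro ⟨x₁, z₁, hx₁, hz₁, hne, hadj⟩
  obtain ⟨x₂, y₂, hx₂, hy₂, hadj'⟩ := h
  exact hadj (hG.adj_of_adj_of_ncard_lt hadj' (by omega) (by omega) hne)

theorem IsSwitchTame.adjSign_eq_one (hG : G.IsSwitchTame) {x y z : V}
    (h : G.HasEdgeBelow x y) (hyz : (G.neighborSet y).ncard < (G.neighborSet z).ncard) :
    G.adjSign x z = 1 := by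
  have h' : G.HasEdgeBelow x z := by
    obtain ⟨x', y', h1, h2, h3⟩ := h
    exact ⟨x', y', h1, by omega, h3⟩
  simp [adjSign, hG.not_hasNonedgeAbove h hyz, h']

theorem IsSwitchTame.adjSign_eq_neg_one (hG : G.IsSwitchTame) {x y z : V}
    (h : G.HasNonedgeAbove x y) (hyz : (G.neighborSet z).ncard < (G.neighborSet y).ncard) :
    G.adjSign x z = -1 := by
  have h1 : ¬ G.HasEdgeBelow x z := fun h' => hG.not_hasNonedgeAbove h' hyz h
  have h2 : G.HasNonedgeAbove x z := by
    obtain ⟨x', y', h1, h2, h3⟩ := h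
    exact ⟨x', y', h1, by omega, h3⟩
  simp [adjSign, h1, h2]

/-- For fixed `x`, going up in the degree of `z`, `G.adjSign x z` is first -1, then 0 on at most one
degree, then 1. Its sum over `z` locates this cut, and the sum of `(D y - D z).sign` locates the
degree of `y`; adding the two tells on which side of the cut `y` lies. -/
theorem IsSwitchTame.exists_weight (hG : G.IsSwitchTame) : ∃ w : V → ℤ,
    G.IsThresholdWeight w ∧
      (∀ x y, (G.neighborSet x).ncard = (G.neighborSet y).ncard → w x = w y) ∧
      ∀ x y, x ≠ y → w x + w y = 0 → G.HasEdgeBelow x y ∧ G.HasNonedgeAbove x y := by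
  classical
  have := Fintype.ofFinite V
  let D : V → ℤ := fun x => (G.neighborSet x).ncard
  let w : V → ℤ := fun x => ∑ z, (G.adjSign x z + (D x - D z).sign)
  -- Exchanging the degree terms of `x` and `y` leaves one sum that compares `y` with the cut of `x`
  -- and one that compares `x` with the cut of `y`. Within each sum the summands never have opposite
  -- signs.
  have hsum : ∀ x y, w x + w y = ∑ z, (G.adjSign x z + (D y - D z).sign) +
      ∑ z, (G.adjSign y z + (D x - D z).sign) := by
    intro x y; simp only [w, Finset.sum_add_distrib]; ring
  have hsign : ∀ y z, (D y < D z ∧ (D y - D z).sign = -1) ∨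
      (D y = D z ∧ (D y - D z).sign = 0) ∨ (D z < D y ∧ (D y - D z).sign = 1) := by
    intro y z
    rcases lt_trichotomy (D y) (D z) with h | h | h
    · exact .inl ⟨h, Int.sign_eq_neg_one_of_neg (by omega)⟩
    · exact .inr (.inl ⟨h, by simp [h]⟩)
    · exact .inr (.inr ⟨h, Int.sign_eq_one_of_pos (by omega)⟩)
  have hcongr : ∀ x y z, D y = D z → G.adjSign x z = G.adjSign x y := by
    intro x y z h
    have h' : (G.neighborSet y).ncard = (G.neighborSet z).ncard := Int.ofNat_inj.1 h
    have h1 : G.HasEdgeBelow x z ↔ G.HasEdgeBelow x y := by simp only [HasEdgeBelow, h']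
    have h2 : G.HasNonedgeAbove x z ↔ G.HasNonedgeAbove x y := by simp only [HasNonedgeAbove, h']
    simp only [adjSign, h1, h2]
  have hE : ∀ x y, G.HasEdgeBelow x y → ∀ z, 0 ≤ G.adjSign x z + (D y - D z).sign := by
    intro x y h z
    rcases hsign y z with ⟨h1, h2⟩ | ⟨h1, h2⟩ | ⟨h1, h2⟩
    · rw [hG.adjSign_eq_one h (Int.ofNat_lt.1 h1), h2]; norm_num
    · rw [h2, hcongr x y z h1]
      simp only [adjSign, h, if_true]; split_ifs <;> norm_num
    · rw [h2]; linarith [G.neg_one_le_adjSign x z]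
  have hF : ∀ x y, G.HasNonedgeAbove x y → ∀ z, G.adjSign x z + (D y - D z).sign ≤ 0 := by
    intro x y h z
    rcases hsign y z with ⟨h1, h2⟩ | ⟨h1, h2⟩ | ⟨h1, h2⟩
    · rw [h2]; linarith [G.adjSign_le_one x z]
    · rw [h2, hcongr x y z h1]
      simp only [adjSign, h, if_true]; split_ifs <;> norm_num
    · rw [hG.adjSign_eq_neg_one h (Int.ofNat_lt.1 h1), h2]; norm_num
  have hE0 : ∀ x y, G.HasEdgeBelow x y → 0 ≤ ∑ z, (G.adjSign x z + (D y - D z).sign) :=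
    fun x y h => Finset.sum_nonneg fun z _ => hE x y h z
  have hF0 : ∀ x y, G.HasNonedgeAbove x y → ∑ z, (G.adjSign x z + (D y - D z).sign) ≤ 0 :=
    fun x y h => Finset.sum_nonpos fun z _ => hF x y h z
  have hE1 : ∀ x y, G.HasEdgeBelow x y → ¬ G.HasNonedgeAbove x y →
      0 < ∑ z, (G.adjSign x z + (D y - D z).sign) := fun x y h h' =>
    Finset.sum_pos' (fun z _ => hE x y h z) ⟨y, Finset.mem_univ y, by simp [adjSign, h, h']⟩
  have hF1 : ∀ x y, G.HasNonedgeAbove x y → ¬ G.HasEdgeBelow x y →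
      ∑ z, (G.adjSign x z + (D y - D z).sign) < 0 := fun x y h h' =>
    Finset.sum_neg' (fun z _ => hF x y h z) ⟨y, Finset.mem_univ y, by simp [adjSign, h, h']⟩
  have hadj : ∀ x y, G.Adj x y → G.HasEdgeBelow x y := fun x y h => ⟨x, y, rfl, le_rfl, h⟩
  have hnadj : ∀ x y, x ≠ y → ¬ G.Adj x y → G.HasNonedgeAbove x y :=
    fun x y h h' => ⟨x, y, rfl, le_rfl, h, h'⟩
  refine ⟨w, ⟨?_, ?_⟩, ?_, ?_⟩
  · intro x y hxy h
    by_contra hcon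
    have h1 := hF0 x y (hnadj x y hxy hcon)
    have h2 := hF0 y x (hnadj y x hxy.symm fun h => hcon h.symm)
    linarith [hsum x y]
  · intro x y h hcon
    have h1 := hE0 x y (hadj x y hcon)
    have h2 := hE0 y x (hadj y x hcon.symm)
    linarith [hsum x y]
  · intro x y h
    refine Finset.sum_congr rfl fun z _ => ?_
    have h1 : G.HasEdgeBelow x z ↔ G.HasEdgeBelow y z := by simp only [HasEdgeBelow, h]
    have h2 : G.HasNonedgeAbove x z ↔ G.HasNonedgeAbove y z := by simp only [HasNonedgeAbove, h]
    simp only [D, adjSign, h1, h2, h]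
  · intro x y hxy h
    by_cases hcon : G.Adj x y
    · refine ⟨hadj x y hcon, ?_⟩
      by_contra h'
      have h1 := hE1 x y (hadj x y hcon) h'
      have h2 := hE0 y x (hadj y x hcon.symm)
      linarith [hsum x y]
    · refine ⟨?_, hnadj x y hxy hcon⟩
      by_contra h'
      have h1 := hF1 x y (hnadj x y hxy hcon) h'
      have h2 := hF0 y x (hnadj y x hxy.symm fun h => hcon h.symm)
      linarith [hsum x y]

end Tame

end SimpleGraph

/-! ### Relations and graphs with unique private neighbors -/

/-- If in a bipartite relation any two points of the same side have exactly one private neighbor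
each, then the relation is a perfect matching or the complement of one. -/
theorem exists_equiv_of_private {A B : Type*} {R : A → B → Prop}
    (hA : ∀ u v, u ≠ v → ∃! x, R u x ∧ ¬ R v x) (hB : ∀ x y, x ≠ y → ∃! u, R u x ∧ ¬ R u y)
    (hR : ∃ u x, R u x) (hR' : ∃ u x, ¬ R u x) :
    ∃ φ : A ≃ B, (∀ u x, R u x ↔ φ u = x) ∨ (∀ u x, R u x ↔ φ u ≠ x) := by
  have matching : ∀ {R : A → B → Prop}, (∀ u v, u ≠ v → ∃! x, R u x ∧ ¬ R v x) →
      (∀ x y, x ≠ y → ∃! u, R u x ∧ ¬ R u y) → ∀ u v x, u ≠ v → R u x →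
      (∀ p, p ≠ u → ¬ R p x) → ∃ φ : A ≃ B, ∀ u x, R u x ↔ φ u = x := by
    intro R hA hB u v x huv hux hx
    -- Column `x` contains only `u`. For another column `z`, the private point of `x` must be `u`,
    -- so `z` avoids `u`; all points of `z` are then private against `x`, hence there is exactly
    -- one.
    have h1 : ∀ z, ∃! a, R a z := by
      intro z
      by_cases hz : z = x
      · subst hz
        exact ⟨u, hux, fun p hp => by by_contra h; exact hx p h hp⟩
      · have h2 : ¬ R u z := by
          intro h
          obtain ⟨a, ⟨ha, ha'⟩, -⟩ := hB x z (Ne.symm hz)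
          have : a = u := by by_contra h'; exact hx a h' ha
          exact ha' (this ▸ h)
        obtain ⟨a, ⟨ha, -⟩, ha'⟩ := hB z x hz
        exact ⟨a, ha, fun p hp => ha' p ⟨hp, fun h => hx p (by rintro rfl; exact h2 hp) h⟩⟩
    choose ψ hψ hψ' using h1
    have hbij : Function.Bijective ψ := by
      constructor
      · intro z z' h
        by_contra hne
        obtain ⟨a, ⟨ha, ha'⟩, -⟩ := hB z z' hne
        apply ha'
        rw [hψ' z a ha, h]
        exact hψ z'
      · intro a
        have : ∃ b, b ≠ a := by
          by_cases h : u = a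
          · exact ⟨v, by rintro rfl; exact huv h⟩
          · exact ⟨u, h⟩
        obtain ⟨b, hb⟩ := this
        obtain ⟨z, ⟨hz, -⟩, -⟩ := hA a b hb.symm
        exact ⟨z, (hψ' z a hz).symm⟩
    refine ⟨(Equiv.ofBijective ψ hbij).symm, fun u x => ?_⟩
    rw [Equiv.symm_apply_eq]
    exact ⟨fun h => hψ' x u h, fun h => h ▸ hψ x⟩
  have hne : ∃ u v : A, u ≠ v := by
    obtain ⟨p, q, hpq⟩ := hR
    obtain ⟨p', q', hpq'⟩ := hR'
    by_cases h : p = p'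
    · subst h
      obtain ⟨u, ⟨-, hu⟩, -⟩ := hB q' q (by rintro rfl; exact hpq' hpq)
      exact ⟨u, p, by rintro rfl; exact hu hpq⟩
    · exact ⟨p, p', h⟩
  obtain ⟨u, v, huv⟩ := hne
  obtain ⟨x, ⟨hux, hvx⟩, -⟩ := hA u v huv
  obtain ⟨y, ⟨hvy, huy⟩, -⟩ := hA v u huv.symm
  have hxy : x ≠ y := by rintro rfl; exact hvx hvy
  have hagree : ∀ p, p ≠ u → p ≠ v → (R p x ↔ R p y) := by
    intro p hpu hpv
    constructor
    · intro h
      by_contra h'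
      exact hpu ((hB x y hxy).unique ⟨h, h'⟩ ⟨hux, huy⟩)
    · intro h
      by_contra h'
      exact hpv ((hB y x hxy.symm).unique ⟨h, h'⟩ ⟨hvy, hvx⟩)
  -- Columns `x` and `y` differ only at `u` and `v`. If `x` contains another `p`, then it contains
  -- every `q ≠ v`, since otherwise `x` and `y` would both be private for `p` against `q`. Column
  -- `x` of the complement is then the single point `v`.
  by_cases h0 : ∀ p, p ≠ u → ¬ R p x
  · obtain ⟨φ, hφ⟩ := matching hA hB u v x huv hux h0
    exact ⟨φ, .inl hφ⟩
  push Not at h0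
  obtain ⟨p, hpu, hpx⟩ := h0
  have hpv : p ≠ v := by rintro rfl; exact hvx hpx
  have h1 : ∀ q, q ≠ v → ¬ ¬ R q x := by
    intro q hqv hqx
    have hqu : q ≠ u := by rintro rfl; exact hqx hux
    exact hxy ((hA p q (by rintro rfl; exact hqx hpx)).unique ⟨hpx, hqx⟩
      ⟨(hagree p hpu hpv).1 hpx, fun h => hqx ((hagree q hqu hqv).2 h)⟩)
  obtain ⟨φ, hφ⟩ := matching (R := fun a b => ¬ R a b)
    (fun a b hab => by simpa [and_comm] using hA b a hab.symm)
    (fun a b hab => by simpa [and_comm] using hB b a hab.symm) v u x huv.symm hvx h1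
  exact ⟨φ, .inr fun a b => by rw [← not_iff_not, hφ]; simp⟩

namespace SimpleGraph

/-- A graph with an edge in which any two vertices have exactly one private neighbor each is a
5-cycle. -/
theorem nonempty_iso_cycleGraph_five {W : Type*} {K : SimpleGraph W}
    (hK : ∀ x y, x ≠ y → ∃! z, K.Adj x z ∧ z ≠ y ∧ ¬ K.Adj y z) (hE : ∃ x y, K.Adj x y) :
    Nonempty (K ≃g cycleGraph 5) := by
  obtain ⟨x, y, hxy⟩ := hE
  -- Seen from `x`, each neighbor has exactly one neighbor among the non-neighbors, and each
  -- non-neighbor misses exactly one neighbor. This leaves two vertices of each kind.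
  have hf : ∀ p, K.Adj x p → ∃! z, K.Adj p z ∧ z ≠ x ∧ ¬ K.Adj x z := fun p hp =>
    hK p x hp.ne.symm
  have hg : ∀ z, z ≠ x → ∃! p, K.Adj x p ∧ p ≠ z ∧ ¬ K.Adj z p := fun z hz => hK x z hz.symm
  obtain ⟨z, ⟨hyz, hzx, hxz⟩, hz⟩ := hf y hxy
  obtain ⟨y₂, ⟨hxy₂, hy₂z, hzy₂⟩, hy₂⟩ := hg z hzx
  obtain ⟨z₂, ⟨hyz₂, hz₂x, hxz₂⟩, hz₂⟩ := hf y₂ hxy₂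
  have hzz : z₂ ≠ z := by rintro rfl; exact hzy₂ hyz₂.symm
  have hyy : y₂ ≠ y := by rintro rfl; exact hzy₂ hyz.symm
  have hyz2 : ¬ K.Adj y z₂ := fun h => hzz (hz z₂ ⟨h, hz₂x, hxz₂⟩)
  have hN : ∀ p, K.Adj x p → p = y ∨ p = y₂ := by
    intro p hp
    by_contra! hcon
    have h1 : K.Adj p z := by
      by_contra h
      exact hcon.2 (hy₂ p ⟨hp, by rintro rfl; exact hxz hp, fun h' => h h'.symm⟩)
    have h2 : K.Adj p z₂ := by
      by_contra h
      exact hcon.1 ((hg z₂ hz₂x).unique ⟨hp, by rintro rfl; exact hxz₂ hp, fun h' => h h'.symm⟩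
        ⟨hxy, by rintro rfl; exact hxz₂ hxy, fun h' => hyz2 h'.symm⟩)
    exact hzz ((hf p hp).unique ⟨h2, hz₂x, hxz₂⟩ ⟨h1, hzx, hxz⟩)
  have hZ : ∀ p, p ≠ x → ¬ K.Adj x p → p = z ∨ p = z₂ := by
    intro p hpx hp
    by_cases h1 : K.Adj y p
    · exact .inl (hz p ⟨h1, hpx, hp⟩)
    by_cases h2 : K.Adj y₂ p
    · exact .inr (hz₂ p ⟨h2, hpx, hp⟩)
    exact absurd ((hg p hpx).unique ⟨hxy₂, by rintro rfl; exact hp hxy₂, fun h' => h2 h'.symm⟩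
      ⟨hxy, by rintro rfl; exact hp hxy, fun h' => h1 h'.symm⟩) hyy
  have hyy' : ¬ K.Adj y y₂ := by
    obtain ⟨p, ⟨h1, h2, h3⟩, -⟩ := hK x y hxy.ne
    rcases hN p h1 with rfl | rfl
    · exact absurd rfl h2
    · exact h3
  have hzz' : K.Adj z z₂ := by
    by_contra h
    exact hz₂x ((hK y₂ z hy₂z).unique ⟨hyz₂, hzz, h⟩ ⟨hxy₂.symm, hzx.symm, fun h => hxz h.symm⟩)
  have hall : ∀ p, p = x ∨ p = y ∨ p = z ∨ p = z₂ ∨ p = y₂ := by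
    intro p
    by_cases h1 : p = x
    · exact .inl h1
    by_cases h2 : K.Adj x p
    · rcases hN p h2 with h | h <;> simp [h]
    · rcases hZ p h1 h2 with h | h <;> simp [h]
  have hyz₂' : y ≠ z₂ := by rintro rfl; exact hxz₂ hxy
  -- The cyclic order of the 5-cycle.
  let f : Fin 5 → W := ![x, y, z, z₂, y₂]
  have hinj : Function.Injective f := by
    intro i j
    fin_cases i <;> fin_cases j <;>
      simp [f, hxy.ne, hxy.ne.symm, hzx, hzx.symm, hz₂x, hz₂x.symm, hxy₂.ne, hxy₂.ne.symm,
        hyz.ne, hyz.ne.symm, hyz₂', hyz₂'.symm, hyy, hyy.symm, hzz, hzz.symm, hy₂z, hy₂z.symm,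
        hyz₂.ne, hyz₂.ne.symm]
  have hsurj : Function.Surjective f := by
    intro p
    rcases hall p with h | h | h | h | h
    exacts [⟨0, h.symm⟩, ⟨1, h.symm⟩, ⟨2, h.symm⟩, ⟨3, h.symm⟩, ⟨4, h.symm⟩]
  refine ⟨RelIso.symm ⟨Equiv.ofBijective f ⟨hinj, hsurj⟩, ?_⟩⟩
  intro i j
  change K.Adj (f i) (f j) ↔ _
  have hs : ∀ {a b}, ¬ K.Adj a b → ¬ K.Adj b a := fun h h' => h h'.symm
  fin_cases i <;> fin_cases j <;>
    simp [f, hxy, hxy.symm, hxz, hs hxz, hxz₂, hs hxz₂, hxy₂, hxy₂.symm, hyz, hyz.symm, hyz2,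
      hs hyz2, hyy', hs hyy', hzz', hzz'.symm, hzy₂, hs hzy₂, hyz₂, hyz₂.symm,
      cycleGraph_adj] <;> decide

/-! ### Tight weights and private neighbors inside a level -/

section Level

variable {V : Type*} {G : SimpleGraph V} {w : V → ℤ}

/-- A threshold weight for which the undecided pairs of two opposite weights have a common
structure: they contain edges as well as nonedges, and degrees are constant. -/
structure IsTightWeight (G : SimpleGraph V) (w : V → ℤ) : Prop extends
    G.IsThresholdWeight w where
  exists_adj : ∀ ⦃x y⦄, x ≠ y → w x + w y = 0 → ∃ x' y', w x' = w x ∧ w y' = w y ∧ G.Adj x' y'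
  exists_not_adj : ∀ ⦃x y⦄, x ≠ y → w x + w y = 0 →
    ∃ x' y', w x' = w x ∧ w y' = w y ∧ x' ≠ y' ∧ ¬ G.Adj x' y'
  ncard_eq : ∀ ⦃x x' y⦄, x ≠ y → x' ≠ y → w x' = w x → w x + w y = 0 →
    (G.neighborSet x').ncard = (G.neighborSet x).ncard

/-- For an undecided pair, the edge provided by `HasEdgeBelow` must end exactly in the degree class
of `y`: an end of smaller degree would rule out `HasNonedgeAbove`. The nonedge is treated in the
same way, and equal degrees have equal weights. -/
theorem IsSwitchTame.exists_tightWeight [Finite V] (hG : G.IsSwitchTame) :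
    ∃ w : V → ℤ, G.IsTightWeight w := by
  obtain ⟨w, hw, hdeg, h0⟩ := hG.exists_weight
  refine ⟨w, hw, ?_, ?_, ?_⟩
  · intro x y hxy h
    obtain ⟨⟨x', y', h1, h2, h3⟩, hF⟩ := h0 x y hxy h
    rcases h2.lt_or_eq with h4 | h4
    · exact absurd hF (hG.not_hasNonedgeAbove ⟨x', y', h1, le_rfl, h3⟩ h4)
    · exact ⟨x', y', hdeg _ _ h1, hdeg _ _ h4, h3⟩
  · intro x y hxy h
    obtain ⟨hE, ⟨x', y', h1, h2, h3, h4⟩⟩ := h0 x y hxy h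
    rcases h2.lt_or_eq with h5 | h5
    · exact absurd ⟨x', y', h1, le_rfl, h3, h4⟩ (hG.not_hasNonedgeAbove hE h5)
    · exact ⟨x', y', hdeg _ _ h1, hdeg _ _ h5.symm, h3, h4⟩
  · intro x x' y hxy hxy' hxx' h
    have h1 := h0 y x hxy.symm (by omega)
    have h2 := h0 y x' hxy'.symm (by omega)
    rcases lt_trichotomy (G.neighborSet x').ncard (G.neighborSet x).ncard with h3 | h3 | h3
    · exact absurd h1.2 (hG.not_hasNonedgeAbove h2.1 h3)
    · exact h3
    · exact absurd h2.2 (hG.not_hasNonedgeAbove h1.1 h3)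

/-- Two vertices alone form a single pair, which cannot supply both an edge and a nonedge. -/
theorem IsTightWeight.exists_third (hw : G.IsTightWeight w) {x y : V} (hxy : x ≠ y)
    (hx : w x = 0) (hy : w y = 0) : ∃ z, z ≠ x ∧ z ≠ y ∧ w z = 0 := by
  obtain ⟨p, q, hp, hq, h⟩ := hw.exists_adj hxy (by omega)
  obtain ⟨p', q', hp', hq', hne, h'⟩ := hw.exists_not_adj hxy (by omega)
  by_contra! hcon
  have key : ∀ z, w z = 0 → z = x ∨ z = y := by
    intro z hz
    by_contra! h
    exact hcon z h.1 h.2 hz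
  have hne' := h.ne
  have h1 := G.adj_comm x y
  rcases key p (by omega) with rfl | rfl <;> rcases key q (by omega) with rfl | rfl <;>
    rcases key p' (by omega) with h2 | h2 <;> rcases key q' (by omega) with h3 | h3 <;>
    subst h2 <;> subst h3 <;> tauto

/-- Uniqueness is tameness together with equal degrees. Without existence, `x` and `x'` would be
twins; comparing them with a vertex `v` of their level that is not a twin of `x` contradicts
tameness. -/
theorem IsTightWeight.existsUnique_private [Finite V] (hG : G.IsSwitchTame)
    (hw : G.IsTightWeight w) {x x' y : V} (hxx' : x ≠ x') (hx : w x = w x')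
    (hy : w x + w y = 0) (hxy : x ≠ y) (hxy' : x' ≠ y) :
    ∃! z, G.Adj x z ∧ z ≠ x' ∧ ¬ G.Adj x' z := by
  -- degrees are constant on the level of `x`
  have hdeg : ∀ v, w v = w x → (G.neighborSet v).ncard = (G.neighborSet x).ncard := by
    intro v hv
    by_cases hvy : v = y
    · subst hvy
      exact hw.ncard_eq (y := x') hxx' hxy'.symm hv (by omega)
    · exact hw.ncard_eq (y := y) hxy hvy hv (by omega)
  have hdeg' : ∀ u v, w u = - w x → w v = - w x →
      (G.neighborSet u).ncard = (G.neighborSet v).ncard := by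
    intro u v hu hv
    by_cases h0 : w x = 0
    · rw [hdeg u (by omega), hdeg v (by omega)]
    · exact hw.ncard_eq (y := x) (by rintro rfl; omega) (by rintro rfl; omega) (by omega)
        (by omega)
  have hex : ∃ z, G.Adj x z ∧ z ≠ x' ∧ ¬ G.Adj x' z := by
    by_contra! htw
    have twin : ∀ z, z ≠ x → z ≠ x' → (G.Adj x z ↔ G.Adj x' z) := by
      intro z hz hz'
      refine ⟨fun h => htw z h hz', fun h => ?_⟩
      by_contra hcon
      obtain ⟨t, ht, ht', htx⟩ := exists_private_of_ncard_le (hdeg x' hx.symm).le h hcon hz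
      exact ht' (htw t ht htx)
    -- some vertex `v` of the level of `x` is not a twin of `x`
    have hv : ∃ v, w v = w x ∧ ∃ z, z ≠ x ∧ z ≠ v ∧ ¬ (G.Adj x z ↔ G.Adj v z) := by
      by_contra! hcon
      obtain ⟨p, q, hp, hq, hpq⟩ := hw.exists_adj hxy hy
      obtain ⟨p', q', hp', hq', hne', hpq'⟩ := hw.exists_not_adj hxy hy
      have tw : ∀ u v, w u = w x → w v = w x → ∀ z, z ≠ u → z ≠ v →
          (G.Adj u z ↔ G.Adj v z) := by
        intro u v hu hv z hzu hzv
        by_cases hzx : z = x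
        · subst hzx
          by_cases huv : u = v
          · rw [huv]
          have h1 := hcon u hu v (by rintro rfl; exact hzv rfl) (Ne.symm huv)
          have h2 := hcon v hv u (by rintro rfl; exact hzu rfl) huv
          rw [G.adj_comm u z, G.adj_comm v z, h1, h2, G.adj_comm]
        · rw [← hcon u hu z hzx hzu, ← hcon v hv z hzx hzv]
      -- If the whole level consists of twins, one edge makes `q` adjacent to all of it and one
      -- nonedge makes `q'` adjacent to none of it.
      have hall : ∀ v, w v = w x → v ≠ q → G.Adj v q := fun v hv hvq =>
        (tw p v hp hv q hpq.ne.symm hvq.symm).1 hpq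
      have hnone : ∀ v, w v = w x → v ≠ q' → ¬ G.Adj v q' := fun v hv hvq h =>
        hpq' ((tw v p' hv hp' q' hvq.symm hne'.symm).1 h)
      have hqq : q ≠ q' := by rintro rfl; exact hnone p hp hpq.ne hpq
      by_cases h0 : w x = 0
      · exact hnone q (by omega) hqq (hall q' (by omega) hqq.symm).symm
      -- Since `q` and `q'` have equal degrees, `q'` has a private neighbor `t` against `q`, and the
      -- weight inequalities put `t` on the level of `x`, all of which is adjacent to `q`.
      · obtain ⟨t, ht, ht', htq⟩ := exists_private_of_ncard_le
          (hdeg' q q' (by omega) (by omega)).le hpq.symm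
          (fun h => hnone p hp (by rintro rfl; omega) h.symm) (by rintro rfl; omega)
        have h1 : 0 ≤ w q' + w t := by by_contra! h'; exact hw.not_adj h' ht
        have h2 : w q + w t ≤ 0 := by by_contra! h'; exact ht' (hw.adj htq.symm h')
        exact ht' (hall t (by omega) htq).symm
    obtain ⟨v, hv, z, hzx, hzv, hz⟩ := hv
    have hpriv : ∃ a b, G.Adj x a ∧ ¬ G.Adj v a ∧ a ≠ v ∧ G.Adj v b ∧ ¬ G.Adj x b ∧ b ≠ x := by
      by_cases h : G.Adj x z
      · have h' : ¬ G.Adj v z := fun h' => hz (by tauto)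
        obtain ⟨b, hb⟩ := exists_private_of_ncard_le (hdeg v hv).ge h h' hzv
        exact ⟨z, b, h, h', hzv, hb⟩
      · have h' : G.Adj v z := by tauto
        obtain ⟨b, hb⟩ := exists_private_of_ncard_le (hdeg v hv).le h' h hzx
        exact ⟨b, z, hb.1, hb.2.1, hb.2.2, h', h, hzx⟩
    obtain ⟨a, b, hxa, hva, hav, hvb, hxb, hbx⟩ := hpriv
    have hvx : v ≠ x := by rintro rfl; exact hva hxa
    have hvx' : v ≠ x' := by
      rintro rfl
      exact hva ((twin a hxa.ne.symm hav).1 hxa)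
    -- The twin `x'` completes an induced `2K₂` if it is `a` and an induced `C₄` if it is `b`.
    -- Otherwise `x` and `x'` are both private for `a` against `b`.
    by_cases ha : x' = a
    · subst ha
      have h1 : ¬ G.Adj x v := fun h => hva ((twin v hvx hvx').1 h).symm
      have hbx' : b ≠ x' := by rintro rfl; exact hxb hxa
      have h2 : ¬ G.Adj x' b := fun h => hxb ((twin b hbx hbx').2 h)
      have h3 := IsAlternatingFourCycle.of_adj hxa hvb hxb (fun h => hva h.symm) hbx.symm hav
      exact h1 ((hG.diagonal h3).2 h2)
    by_cases hb : x' = b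
    · subst hb
      have h1 : G.Adj x v := (twin v hvx hvx').2 hvb.symm
      have h2 : G.Adj x' a := (twin a hxa.ne.symm (Ne.symm ha)).1 hxa
      have h3 := IsAlternatingFourCycle.of_adj h1 h2.symm hxb hva hxx' hav.symm
      exact (hG.diagonal h3).1 hxa hvb
    have h1 : G.Adj x' a := (twin a hxa.ne.symm (Ne.symm ha)).1 hxa
    have h2 : ¬ G.Adj x' b := fun h => hxb ((twin b hbx (Ne.symm hb)).2 h)
    exact hxx' (hG.private_unique (u := b) (v := a) (x := v) hvb.symm (fun h => hva h.symm)
      (Ne.symm hav) hxa.symm (fun h => hxb h.symm) hbx.symm h1.symm (fun h => h2 h.symm) hb)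
  obtain ⟨z, hz, hzx, hz'⟩ := hex
  refine ⟨z, ⟨hz, hzx, hz'⟩, ?_⟩
  rintro t ⟨ht, htx, ht'⟩
  obtain ⟨s, hs, hs', hsx⟩ := exists_private_of_ncard_le (hdeg x' hx.symm).ge hz hz' hzx
  exact hG.private_unique hs hs' hsx ht ht' htx hz hz' hzx

end Level

end SimpleGraph

namespace SimpleGraph

/-! ### Matching split graphs and transposition graphs -/

section Net

variable {α : Type*}

/-- The split graph on `α ⊕ α` in which the left copy is a clique, the right copy is independent,
and the edges between them are the perfect matching given by the permutation `σ` if `ε` holds,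
and the complement of this matching otherwise. -/
def permSplitGraph (ε : Prop) (σ : Equiv.Perm α) : SimpleGraph (α ⊕ α) where
  Adj
    | .inl i, .inl j => i ≠ j
    | .inl i, .inr j => (σ i = j ↔ ε)
    | .inr j, .inl i => (σ i = j ↔ ε)
    | .inr _, .inr _ => False
  symm := ⟨by rintro (i | i) (j | j) h <;> first | exact Ne.symm h | exact h⟩
  loopless := ⟨by rintro (i | i) h <;> first | exact h rfl | exact h⟩

@[simp] theorem permSplitGraph_inl_inl {ε : Prop} {σ : Equiv.Perm α} {i j : α} :
    (permSplitGraph ε σ).Adj (.inl i) (.inl j) ↔ i ≠ j := Iff.rfl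

@[simp] theorem permSplitGraph_inl_inr {ε : Prop} {σ : Equiv.Perm α} {i j : α} :
    (permSplitGraph ε σ).Adj (.inl i) (.inr j) ↔ (σ i = j ↔ ε) := Iff.rfl

@[simp] theorem permSplitGraph_inr_inl {ε : Prop} {σ : Equiv.Perm α} {i j : α} :
    (permSplitGraph ε σ).Adj (.inr j) (.inl i) ↔ (σ i = j ↔ ε) := Iff.rfl

@[simp] theorem permSplitGraph_inr_inr {ε : Prop} {σ : Equiv.Perm α} {i j : α} :
    ¬ (permSplitGraph ε σ).Adj (.inr i) (.inr j) := id

/-- The threshold weight of the graphs `permSplitGraph ε σ`. -/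
def splitWeight : α ⊕ α → ℤ := Sum.elim (fun _ => 1) (fun _ => -1)

theorem isThresholdWeight_splitWeight (ε : Prop) (σ : Equiv.Perm α) :
    (permSplitGraph ε σ).IsThresholdWeight splitWeight := by
  constructor
  · rintro (i | i) (j | j) h h' <;> simp_all [splitWeight]
  · rintro (i | i) (j | j) h <;> simp_all [splitWeight]

theorem permSplitGraph_injective (ε : Prop) :
    Function.Injective (permSplitGraph (α := α) ε) := by
  intro σ τ h
  ext i
  have h1 : (permSplitGraph ε σ).Adj (.inl i) (.inr (τ i)) ↔
    (permSplitGraph ε τ).Adj (.inl i) (.inr (τ i)) := by rw [h]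
  simp only [permSplitGraph_inl_inr, true_iff] at h1
  by_cases hε : ε <;> simpa [hε] using h1

/-- Relabelling one side by `σ` or its inverse turns the matching of `σ` into the identity matching.
-/
theorem ncard_neighborSet_permSplitGraph (ε : Prop) (σ : Equiv.Perm α) (v : α ⊕ α) :
    ((permSplitGraph ε σ).neighborSet v).ncard = ((permSplitGraph ε 1).neighborSet v).ncard := by
  rcases v with i | j
  · rw [← Set.ncard_image_of_injective _ (Equiv.sumCongr (1 : Equiv.Perm α) σ⁻¹).injective]
    congr 1
    ext (x | x) <;> simp [Equiv.eq_symm_apply]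
  · rw [← Set.ncard_image_of_injective _ (Equiv.sumCongr σ (1 : Equiv.Perm α)).injective]
    congr 1
    ext (x | x) <;> simp

/-- The matching and its complement differ only in which of the two index orders makes `inl i, inr
p` an edge. -/
theorem exists_twoSwitch_permSplitGraph [DecidableEq α] (ε : Prop) (σ : Equiv.Perm α) {i j : α} (hij : i ≠ j) :
    ∃ p q, (ε → p = σ i ∧ q = σ j) ∧ (¬ ε → p = σ j ∧ q = σ i) ∧
      (permSplitGraph ε σ).IsAlternatingFourCycle (.inl i) (.inr p) (.inl j) (.inr q) ∧
      permSplitGraph ε (σ * Equiv.swap i j) =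
        (permSplitGraph ε σ).twoSwitch (.inl i) (.inr p) (.inl j) (.inr q) := by
  have hσ : σ i ≠ σ j := fun h => hij (σ.injective h)
  by_cases hε : ε
  · have h : (permSplitGraph ε σ).IsAlternatingFourCycle
        (.inl i) (.inr (σ i)) (.inl j) (.inr (σ j)) := by
      apply IsAlternatingFourCycle.of_adj <;> simp [hε, hσ, hσ.symm]
    refine ⟨σ i, σ j, fun _ => ⟨rfl, rfl⟩, fun h => absurd hε h, h, ?_⟩
    ext (x | x) (y | y) <;> rw [h.twoSwitch_adj] <;>
      simp only [permSplitGraph_inl_inl, permSplitGraph_inl_inr, permSplitGraph_inr_inl,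
        permSplitGraph_inr_inr, Equiv.Perm.mul_apply, Equiv.swap_apply_def, hε, Sym2.eq_iff, ne_eq,
        Sum.inl.injEq, Sum.inr.injEq, reduceCtorEq, iff_true, and_false, false_and,
        or_false, false_or, not_false_eq_true, and_true] <;>
      grind
  · have h : (permSplitGraph ε σ).IsAlternatingFourCycle
        (.inl i) (.inr (σ j)) (.inl j) (.inr (σ i)) := by
      apply IsAlternatingFourCycle.of_adj <;> simp [hε, hσ, hσ.symm]
    refine ⟨σ j, σ i, fun h => absurd h hε, fun _ => ⟨rfl, rfl⟩, h, ?_⟩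
    ext (x | x) (y | y) <;> rw [h.twoSwitch_adj] <;>
      simp only [permSplitGraph_inl_inl, permSplitGraph_inl_inr, permSplitGraph_inr_inl,
        permSplitGraph_inr_inr, Equiv.Perm.mul_apply, Equiv.swap_apply_def, hε, Sym2.eq_iff, ne_eq,
        Sum.inl.injEq, Sum.inr.injEq, reduceCtorEq, iff_false, and_false, false_and,
        or_false, false_or, not_false_eq_true, and_true] <;>
      grind

theorem exists_of_isAlternatingFourCycle_permSplitGraph {ε : Prop} {σ : Equiv.Perm α}
    {a b c e : α ⊕ α} (ha : 0 ≤ splitWeight a)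
    (h : (permSplitGraph ε σ).IsAlternatingFourCycle a b c e) : ∃ i j p q, i ≠ j ∧
      a = .inl i ∧ b = .inr p ∧ c = .inl j ∧ e = .inr q ∧
      (ε → p = σ i ∧ q = σ j) ∧ (¬ ε → p = σ j ∧ q = σ i) := by
  have hl := (isThresholdWeight_splitWeight ε σ).level h
  rcases a with i | i <;> rcases b with p | p <;> rcases c with j | j <;> rcases e with q | q <;>
    simp [splitWeight] at ha hl
  have h1 := h.adj_ab
  have h2 := h.adj_ce
  have h3 := h.not_adj_ae
  have h4 := h.not_adj_bc
  simp only [permSplitGraph_inl_inr, permSplitGraph_inr_inl] at h1 h2 h3 h4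
  refine ⟨i, j, p, q, fun hij => h.ne_ac (by rw [hij]), rfl, rfl, rfl, rfl, ?_, ?_⟩
  · intro hε; simp only [hε, iff_true] at h1 h2; exact ⟨h1.symm, h2.symm⟩
  · intro hε; simp only [hε, iff_false, not_not] at h3 h4; exact ⟨h4.symm, h3.symm⟩

theorem existsUnique_of_ncard_setOf_eq {β : Type*} [Finite β] {ε : Prop} {P : β → Prop} {b : β}
    (h : {x | P x}.ncard = {x | b = x ↔ ε}.ncard) : ∃! x, P x ↔ ε := by
  have h1 : {x | P x ↔ ε}.ncard = 1 := by
    by_cases hε : ε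
    · simp only [hε, iff_true] at h ⊢
      rw [h]
      simp
    · simp only [hε, iff_false] at h ⊢
      have h2 := Set.ncard_add_ncard_compl {x | P x}
      have h3 := Set.ncard_add_ncard_compl {x | ¬ b = x}
      have h4 : ({x | ¬ b = x}ᶜ : Set β).ncard = 1 := by
        simp [Set.compl_ofPred]
      have h5 : {x | P x}ᶜ = {x | ¬ P x} := rfl
      rw [h5] at h2
      omega
  obtain ⟨x, hx⟩ := Set.ncard_eq_one.1 h1
  exact ⟨x, hx.ge rfl, fun y hy => hx.le hy⟩

/-- The threshold weight forces the clique and the independent set. The degrees then leave each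
vertex exactly one exceptional partner across, and these partners form a permutation. -/
theorem exists_eq_permSplitGraph [Finite α] {ε : Prop} {H : SimpleGraph (α ⊕ α)}
    (hH : ∀ v, (H.neighborSet v).ncard = ((permSplitGraph ε 1).neighborSet v).ncard) :
    ∃ σ, H = permSplitGraph ε σ := by
  have hforced := fun {x y} => (isThresholdWeight_splitWeight ε 1).adj_iff_of_ncard_eq hH
    (x := x) (y := y)
  have hll : ∀ i j, H.Adj (.inl i) (.inl j) ↔ i ≠ j := fun i j => hforced (by simp [splitWeight])
  have hrr : ∀ i j, ¬ H.Adj (.inr i) (.inr j) := fun i j h =>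
    permSplitGraph_inr_inr ((hforced (by simp [splitWeight])).1 h)
  have hsplit : ∀ (K : SimpleGraph (α ⊕ α)) v, (K.neighborSet v).ncard =
      {x | K.Adj v (.inl x)}.ncard + {x | K.Adj v (.inr x)}.ncard := by
    intro K v
    rw [← Set.ncard_image_of_injective {x | K.Adj v (.inl x)} (Sum.inl_injective (β := α)),
      ← Set.ncard_image_of_injective {x | K.Adj v (.inr x)} (Sum.inr_injective (α := α)),
      ← Set.ncard_union_eq]
    · congr 1
      ext (x | x) <;> simp
    · rw [Set.disjoint_left]
      rintro _ ⟨x, -, rfl⟩ ⟨y, -, h⟩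
      simp at h
  have h1 : ∀ i, ∃! j, H.Adj (.inl i) (.inr j) ↔ ε := by
    intro i
    apply existsUnique_of_ncard_setOf_eq (b := i)
    have := hH (.inl i)
    rw [hsplit, hsplit] at this
    simpa [hll] using this
  have h2 : ∀ j, ∃! i, H.Adj (.inl i) (.inr j) ↔ ε := by
    intro j
    apply existsUnique_of_ncard_setOf_eq (b := j)
    have := hH (.inr j)
    rw [hsplit, hsplit] at this
    simpa [hrr, H.adj_comm, eq_comm] using this
  choose f hf hf' using h1
  have hbij : Function.Bijective f := by
    constructor
    · intro i i' h
      exact (h2 (f i)).unique (hf i) (h ▸ hf i')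
    · intro j
      obtain ⟨i, hi, -⟩ := h2 j
      exact ⟨i, (hf' i j hi).symm⟩
  have hlr : ∀ i j, H.Adj (.inl i) (.inr j) ↔ (f i = j ↔ ε) := by
    intro i j
    have h3 : (H.Adj (.inl i) (.inr j) ↔ ε) ↔ f i = j :=
      ⟨fun h => (hf' i j h).symm, fun h => h ▸ hf i⟩
    tauto
  refine ⟨Equiv.ofBijective f hbij, ?_⟩
  ext (x | x) (y | y)
  · exact hll x y
  · exact hlr x y
  · exact (H.adj_comm _ _).trans (hlr y x)
  · simp [hrr]

theorem nonempty_iso_transpositionGraph (k : ℕ) (ε : Prop) :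
    Nonempty (degreeRealizationGraph
      (fun v => ((permSplitGraph ε (1 : Equiv.Perm (Fin k))).neighborSet v).ncard) ≃g
        transpositionGraph k) := by
  let f : Equiv.Perm (Fin k) → {H : SimpleGraph (Fin k ⊕ Fin k) // ∀ v, (H.neighborSet v).ncard =
      ((permSplitGraph ε (1 : Equiv.Perm (Fin k))).neighborSet v).ncard} :=
    fun σ => ⟨permSplitGraph ε σ, ncard_neighborSet_permSplitGraph ε σ⟩
  have hf : Function.Bijective f := by
    constructor
    · intro σ τ h
      exact permSplitGraph_injective ε (congrArg Subtype.val h)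
    · rintro ⟨H, hH⟩
      obtain ⟨σ, rfl⟩ := exists_eq_permSplitGraph hH
      exact ⟨σ, rfl⟩
  refine ⟨RelIso.symm ⟨Equiv.ofBijective f hf, ?_⟩⟩
  intro σ τ
  change TwoSwitchRel (permSplitGraph ε σ) (permSplitGraph ε τ) ↔ (σ⁻¹ * τ).IsSwap
  constructor
  · intro h
    obtain ⟨a, b, c, e, ha, h, heq⟩ :=
      (isThresholdWeight_splitWeight ε σ).exists_twoSwitch_nonneg h
    obtain ⟨i, j, p, q, hij, rfl, rfl, rfl, rfl, h1, h2⟩ :=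
      exists_of_isAlternatingFourCycle_permSplitGraph ha h
    obtain ⟨p', q', h1', h2', -, heq'⟩ := exists_twoSwitch_permSplitGraph ε σ hij
    have hpq : p = p' ∧ q = q' := by
      by_cases hε : ε
      · exact ⟨(h1 hε).1.trans (h1' hε).1.symm, (h1 hε).2.trans (h1' hε).2.symm⟩
      · exact ⟨(h2 hε).1.trans (h2' hε).1.symm, (h2 hε).2.trans (h2' hε).2.symm⟩
    rw [hpq.1, hpq.2, ← heq'] at heq
    exact ⟨i, j, hij, by rw [permSplitGraph_injective ε heq, inv_mul_cancel_left]⟩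
  · rintro ⟨i, j, hij, h⟩
    obtain ⟨p, q, -, -, h1, h2⟩ := exists_twoSwitch_permSplitGraph ε σ hij
    refine ⟨_, _, _, _, h1, ?_⟩
    rw [← h2]
    congr 1
    rw [eq_comm, ← eq_inv_mul_iff_mul_eq, h]

end Net

/-! ### Transport along isomorphisms, and rigid graphs -/

section Transport

variable {V W : Type*}

theorem IsAlternatingFourCycle.map_iso {G : SimpleGraph V} {H : SimpleGraph W} (f : G ≃g H)
    {a b c e : V} (h : G.IsAlternatingFourCycle a b c e) :
    H.IsAlternatingFourCycle (f a) (f b) (f c) (f e) := by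
  obtain ⟨hab, hac, hae, hbc, hbe, hce, h1, h2, h3, h4⟩ := h
  constructor <;> simpa [f.map_adj_iff]

theorem TwoSwitchRel.comap {H H' : SimpleGraph W} (f : V ≃ W) (h : TwoSwitchRel H H') :
    TwoSwitchRel (H.comap f) (H'.comap f) := by
  obtain ⟨a, b, c, e, h, rfl⟩ := h
  have h' : (H.comap f).IsAlternatingFourCycle (f.symm a) (f.symm b) (f.symm c) (f.symm e) := by
    obtain ⟨hab, hac, hae, hbc, hbe, hce, h1, h2, h3, h4⟩ := h
    constructor <;> simpa
  refine ⟨_, _, _, _, h', ?_⟩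
  ext x y
  rw [h'.twoSwitch_adj, comap_adj, h.twoSwitch_adj]
  simp [Equiv.eq_symm_apply]

theorem ncard_neighborSet_comap (H : SimpleGraph W) (f : V ≃ W) (v : V) :
    ((H.comap f).neighborSet v).ncard = (H.neighborSet (f v)).ncard := by
  rw [← Set.ncard_image_of_injective _ f.injective]
  congr 1
  ext x
  simp only [Set.mem_image, mem_neighborSet, comap_adj]
  exact ⟨by rintro ⟨y, hy, rfl⟩; exact hy, fun h => ⟨f.symm x, by simpa using h, by simp⟩⟩

/-- The realization graph does not depend on the names of the vertices. -/
def degreeRealizationGraphCongr {d : V → ℕ} {d' : W → ℕ} (f : V ≃ W) (hd : ∀ v, d v = d' (f v)) :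
    degreeRealizationGraph d ≃g degreeRealizationGraph d' where
  toFun H := ⟨H.1.comap f.symm, fun v => by
    rw [ncard_neighborSet_comap, H.2, hd, f.apply_symm_apply]⟩
  invFun H := ⟨H.1.comap f, fun v => by rw [ncard_neighborSet_comap, H.2, hd]⟩
  left_inv H := by ext; simp
  right_inv H := by ext; simp
  map_rel_iff' {H H'} := by
    refine ⟨fun h => ?_, fun h => TwoSwitchRel.comap f.symm h⟩
    have h' : TwoSwitchRel ((H.1.comap f.symm).comap f) ((H'.1.comap f.symm).comap f) :=
      TwoSwitchRel.comap f h
    have key : ∀ K : SimpleGraph V, (K.comap f.symm).comap f = K := fun K => by ext; simp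
    rwa [key, key] at h'

theorem ncard_neighborSet_iso {G : SimpleGraph V} {H : SimpleGraph W} (f : G ≃g H) (v : V) :
    (G.neighborSet v).ncard = (H.neighborSet (f v)).ncard := by
  rw [← Set.ncard_image_of_injective _ f.injective]
  congr 1
  ext x
  simp only [Set.mem_image, mem_neighborSet]
  exact ⟨by rintro ⟨y, hy, rfl⟩; exact f.map_adj_iff.2 hy,
    fun h => ⟨f.symm x, by rw [← f.map_adj_iff]; simpa using h, by simp⟩⟩

/-- Isomorphic graphs have isomorphic realization graphs. -/
noncomputable def degreeRealizationGraphIso {G : SimpleGraph V} {H : SimpleGraph W} (f : G ≃g H) :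
    degreeRealizationGraph (fun v => (G.neighborSet v).ncard) ≃g
      degreeRealizationGraph (fun v => (H.neighborSet v).ncard) :=
  degreeRealizationGraphCongr f.toEquiv fun v => ncard_neighborSet_iso f v

/-- If a threshold weight decides all pairs, there is only one realization. -/
theorem IsThresholdWeight.nonempty_iso_transpositionGraph_one [Finite V] {G : SimpleGraph V}
    {w : V → ℤ} (hw : G.IsThresholdWeight w) (h : ∀ x y, x ≠ y → w x + w y ≠ 0) :
    Nonempty (degreeRealizationGraph (fun v => (G.neighborSet v).ncard) ≃g
      transpositionGraph 1) := by
  have hsub : ∀ H : {H : SimpleGraph V // ∀ v, (H.neighborSet v).ncard =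
      (G.neighborSet v).ncard}, H = ⟨G, fun _ => rfl⟩ := by
    rintro ⟨H, hH⟩
    ext x y
    by_cases hxy : x = y
    · subst hxy; simp
    · exact hw.adj_iff_of_ncard_eq hH (h x y hxy)
  refine ⟨⟨⟨fun _ => 1, fun _ => ⟨G, fun _ => rfl⟩, fun H => (hsub H).symm,
    fun σ => Subsingleton.elim _ _⟩, ?_⟩⟩
  intro H H'
  rw [hsub H, hsub H']
  simp

end Transport

/-! ### The structure of the levels -/

section Level

variable {V : Type*} [Finite V] {G : SimpleGraph V} {w : V → ℤ}

/-- A private neighbor of one weight-zero vertex against another has weight zero again, so the level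
inherits unique private neighbors. The third vertex serves as the `y` of `existsUnique_private`. -/
theorem IsTightWeight.level_zero (hG : G.IsSwitchTame) (hw : G.IsTightWeight w) {S : Set V}
    (hS : ∀ v, v ∈ S ↔ w v = 0) :
    Nonempty (G.induce S ≃g cycleGraph 5) ∨
      ∀ x ∈ S, ∀ y ∈ S, x ≠ y → w x + w y ≠ 0 := by
  by_cases hcon : ∀ x ∈ S, ∀ y ∈ S, x ≠ y → w x + w y ≠ 0
  · exact .inr hcon
  left
  push Not at hcon
  obtain ⟨x, hx, y, hy, hxy, h0⟩ := hcon
  apply nonempty_iso_cycleGraph_five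
  · rintro ⟨u, hu⟩ ⟨v, hv⟩ huv
    have huv' : u ≠ v := fun h => huv (Subtype.ext h)
    rw [hS] at hu hv
    obtain ⟨t, htu, htv, ht⟩ := hw.exists_third huv' hu hv
    obtain ⟨z, ⟨h1, h2, h3⟩, h4⟩ :=
      hw.existsUnique_private hG huv' (hu.trans hv.symm) (by omega) htu.symm htv.symm
    have hz1 : 0 ≤ w u + w z := by by_contra! h; exact hw.not_adj h h1
    have hz2 : w v + w z ≤ 0 := by by_contra! h; exact h3 (hw.adj h2.symm h)
    refine ⟨⟨z, (hS z).2 (by omega)⟩, ⟨h1, fun h => h2 (congrArg Subtype.val h), h3⟩, ?_⟩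
    rintro ⟨z', hz'⟩ ⟨h1', h2', h3'⟩
    exact Subtype.ext (h4 z' ⟨h1', fun h => h2' (Subtype.ext h), h3'⟩)
  · obtain ⟨p, q, hp, hq, h⟩ := hw.exists_adj hxy h0
    rw [hS] at hx hy
    exact ⟨⟨p, (hS p).2 (by omega)⟩, ⟨q, (hS q).2 (by omega)⟩, h⟩

/-- Weight `t` gives a clique and weight `-t` an independent set. Private neighbors of two vertices
on one side lie on the other side, so `exists_equiv_of_private` applies to the edges across. -/
theorem IsTightWeight.level_pos (hG : G.IsSwitchTame) (hw : G.IsTightWeight w) {S : Set V}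
    {t : ℕ} (ht : t ≠ 0) (hS : ∀ v, v ∈ S ↔ (w v).natAbs = t) :
    (∃ (k : ℕ) (ε : Prop), 1 ≤ k ∧
      Nonempty (G.induce S ≃g permSplitGraph ε (1 : Equiv.Perm (Fin k)))) ∨
      ∀ x ∈ S, ∀ y ∈ S, x ≠ y → w x + w y ≠ 0 := by
  by_cases hcon : ∀ x ∈ S, ∀ y ∈ S, x ≠ y → w x + w y ≠ 0
  · exact .inr hcon
  left
  have hxy : ∃ x y, w x = t ∧ w y = -t := by
    push Not at hcon
    obtain ⟨x, hx, y, hy, hxy, h0⟩ := hcon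
    rw [hS] at hx hy
    by_cases h : w x = t
    · exact ⟨x, y, h, by omega⟩
    · exact ⟨y, x, by omega, by omega⟩
  obtain ⟨x, y, hx, hy⟩ := hxy
  have hne : ∀ {u v : V}, w u = t → w v = -t → u ≠ v := by rintro u _ h h' rfl; omega
  have hpriv : ∀ u v, w u = t → w v = t → u ≠ v → ∃! z : {z // w z = -t},
      G.Adj u z ∧ ¬ G.Adj v z := by
    intro u v hu hv huv
    obtain ⟨z, ⟨h1, h2, h3⟩, h4⟩ :=
      hw.existsUnique_private hG huv (hu.trans hv.symm) (y := y) (by omega) (hne hu hy) (hne hv hy)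
    have hz1 : 0 ≤ w u + w z := by by_contra! h; exact hw.not_adj h h1
    have hz2 : w v + w z ≤ 0 := by by_contra! h; exact h3 (hw.adj h2.symm h)
    refine ⟨⟨z, by omega⟩, ⟨h1, h3⟩, ?_⟩
    rintro ⟨z', hz'⟩ ⟨h1', h2'⟩
    exact Subtype.ext (h4 z' ⟨h1', (hne hv hz').symm, h2'⟩)
  have hpriv' : ∀ u v, w u = -t → w v = -t → u ≠ v → ∃! z : {z // w z = t},
      G.Adj z u ∧ ¬ G.Adj z v := by
    intro u v hu hv huv
    obtain ⟨z, ⟨h1, h2, h3⟩, h4⟩ :=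
      hw.existsUnique_private hG huv (hu.trans hv.symm) (y := x) (by omega) (hne hx hu).symm
        (hne hx hv).symm
    have hz1 : 0 ≤ w u + w z := by by_contra! h; exact hw.not_adj h h1
    have hz2 : w v + w z ≤ 0 := by by_contra! h; exact h3 (hw.adj h2.symm h)
    refine ⟨⟨z, by omega⟩, ⟨h1.symm, fun h => h3 h.symm⟩, ?_⟩
    rintro ⟨z', hz'⟩ ⟨h1', h2'⟩
    exact Subtype.ext (h4 z' ⟨h1'.symm, hne hz' hv, fun h => h2' h.symm⟩)
  obtain ⟨p, q, hp, hq, hpq⟩ := hw.exists_adj (hne hx hy) (by omega)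
  obtain ⟨p', q', hp', hq', -, hpq'⟩ := hw.exists_not_adj (hne hx hy) (by omega)
  obtain ⟨φ, hφ⟩ := exists_equiv_of_private
    (R := fun (u : {z // w z = t}) (v : {z // w z = -t}) => G.Adj u v)
    (fun u v huv => hpriv u v u.2 v.2 fun h => huv (Subtype.ext h))
    (fun u v huv => hpriv' u v u.2 v.2 fun h => huv (Subtype.ext h))
    ⟨⟨p, by omega⟩, ⟨q, by omega⟩, hpq⟩ ⟨⟨p', by omega⟩, ⟨q', by omega⟩, hpq'⟩
  have hφ' : ∃ ε : Prop, ∀ u v, G.Adj u.1 v.1 ↔ (φ u = v ↔ ε) := by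
    rcases hφ with h | h
    · exact ⟨True, by simpa using h⟩
    · exact ⟨False, by simpa using h⟩
  obtain ⟨ε, hε⟩ := hφ'
  let e : {z // w z = t} ≃ Fin (Nat.card {z // w z = t}) := Finite.equivFin _
  have hmem : ∀ u : {z // w z = (t : ℤ)}, u.1 ∈ S := fun u => by rw [hS, u.2]; simp
  have hmem' : ∀ u : {z // w z = -(t : ℤ)}, u.1 ∈ S := fun u => by rw [hS, u.2]; simp
  let g : Fin (Nat.card {z // w z = t}) ⊕ Fin (Nat.card {z // w z = t}) → S :=
    Sum.elim (fun i => ⟨e.symm i, hmem _⟩) (fun j => ⟨φ (e.symm j), hmem' _⟩)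
  have hg : Function.Bijective g := by
    constructor
    · rintro (i | i) (j | j) h
      · simpa [g, Subtype.ext_iff, ← Subtype.ext_iff] using h
      · exact absurd (congrArg Subtype.val h) (hne (e.symm i).2 (φ (e.symm j)).2)
      · exact absurd (congrArg Subtype.val h).symm (hne (e.symm j).2 (φ (e.symm i)).2)
      · have h1 : φ (e.symm i) = φ (e.symm j) := Subtype.ext (congrArg (fun s : S => s.1) h)
        simpa using h1
    · rintro ⟨v, hv⟩
      rw [hS] at hv
      by_cases h : w v = t
      · exact ⟨.inl (e ⟨v, h⟩), by simp [g]⟩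
      · exact ⟨.inr (e (φ.symm ⟨v, by omega⟩)), by simp [g]⟩
  refine ⟨_, ε, ?_, ⟨RelIso.symm ⟨Equiv.ofBijective g hg, ?_⟩⟩⟩
  · exact Nat.card_pos_iff.2 ⟨⟨⟨x, hx⟩⟩, inferInstance⟩
  · rintro (i | i) (j | j)
    · change G.Adj (e.symm i).1 (e.symm j).1 ↔ i ≠ j
      constructor
      · rintro h rfl; exact h.ne rfl
      · intro h
        refine hw.adj (fun h' => h (e.symm.injective (Subtype.ext h'))) ?_
        rw [(e.symm i).2, (e.symm j).2]; omega
    · change G.Adj (e.symm i).1 (φ (e.symm j)).1 ↔ (i = j ↔ ε)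
      rw [hε]; simp
    · change G.Adj (φ (e.symm i)).1 (e.symm j).1 ↔ (j = i ↔ ε)
      rw [G.adj_comm, hε]; simp
    · change G.Adj (φ (e.symm i)).1 (φ (e.symm j)).1 ↔ False
      rw [iff_false]
      apply hw.not_adj
      rw [(φ (e.symm i)).2, (φ (e.symm j)).2]; omega

end Level

end SimpleGraph

namespace SimpleGraph

/-! ### Cartesian decomposition along the levels -/

section Product

variable {V : Type*} {ι : Type*} {G : SimpleGraph V} {w : V → ℤ}

theorem IsThresholdWeight.of_ncard_eq [Finite V] (hw : G.IsThresholdWeight w) {H : SimpleGraph V}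
    (hH : ∀ v, (H.neighborSet v).ncard = (G.neighborSet v).ncard) : H.IsThresholdWeight w :=
  ⟨fun _ _ hxy h => (hw.adj_iff_of_ncard_eq hH h.ne').2 (hw.adj hxy h),
    fun _ _ h h' => hw.not_adj h ((hw.adj_iff_of_ncard_eq hH h.ne).1 h')⟩

theorem IsThresholdWeight.induce (hw : G.IsThresholdWeight w) (S : Set V) :
    (G.induce S).IsThresholdWeight (fun v => w v) :=
  ⟨fun _ _ hxy h => hw.adj (fun h' => hxy (Subtype.ext h')) h, fun _ _ h h' => hw.not_adj h h'⟩

theorem ncard_neighborSet_induce (H : SimpleGraph V) (S : Set V) (v : S) :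
    ((H.induce S).neighborSet v).ncard = (H.neighborSet v ∩ S).ncard := by
  rw [← Set.ncard_image_of_injective _ Subtype.val_injective]
  congr 1
  ext x
  simp only [Set.mem_image, mem_neighborSet, comap_adj, Function.Embedding.subtype_apply,
    Subtype.exists, exists_and_right, exists_eq_right, Set.mem_inter_iff]
  exact ⟨fun ⟨h, h'⟩ => ⟨h', h⟩, fun ⟨h, h'⟩ => ⟨h', h⟩⟩

/-- The graph with prescribed restrictions to the fibers of `lev` that agrees with `G` on the pairs
of vertices in different fibers. -/
def glueLevels (G : SimpleGraph V) (lev : V → ι) (K : ∀ i, SimpleGraph {v | lev v = i}) :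
    SimpleGraph V where
  Adj x y := (∃ i, ∃ hx : lev x = i, ∃ hy : lev y = i, (K i).Adj ⟨x, hx⟩ ⟨y, hy⟩) ∨
    (lev x ≠ lev y ∧ G.Adj x y)
  symm := ⟨by
    rintro x y (⟨i, hx, hy, h⟩ | ⟨h, h'⟩)
    · exact .inl ⟨i, hy, hx, h.symm⟩
    · exact .inr ⟨h.symm, h'.symm⟩⟩
  loopless := ⟨by
    rintro x (⟨i, hx, hy, h⟩ | ⟨h, h'⟩)
    · exact h.ne rfl
    · exact h rfl⟩

theorem glueLevels_induce (G : SimpleGraph V) (lev : V → ι)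
    (K : ∀ i, SimpleGraph {v | lev v = i}) (i : ι) :
    (G.glueLevels lev K).induce {v | lev v = i} = K i := by
  ext ⟨x, hx⟩ ⟨y, hy⟩
  change ((∃ j, ∃ hx : lev x = j, ∃ hy : lev y = j, (K j).Adj ⟨x, hx⟩ ⟨y, hy⟩) ∨
    (lev x ≠ lev y ∧ G.Adj x y)) ↔ _
  constructor
  · rintro (⟨j, hx', hy', h⟩ | ⟨h, -⟩)
    · obtain rfl : j = i := hx'.symm.trans hx
      exact h
    · exact absurd (hx.trans hy.symm) h
  · intro h
    exact .inl ⟨i, hx, hy, h⟩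

theorem glueLevels_adj_of_ne (G : SimpleGraph V) (lev : V → ι)
    (K : ∀ i, SimpleGraph {v | lev v = i}) {x y : V} (h : lev x ≠ lev y) :
    (G.glueLevels lev K).Adj x y ↔ G.Adj x y := by
  constructor
  · rintro (⟨i, hx, hy, -⟩ | ⟨-, h'⟩)
    · exact absurd (hx.trans hy.symm) h
    · exact h'
  · exact fun h' => .inr ⟨h, h'⟩

theorem IsAlternatingFourCycle.induce {H : SimpleGraph V} {S : Set V} {a b c e : V}
    (h : H.IsAlternatingFourCycle a b c e) (ha : a ∈ S) (hb : b ∈ S) (hc : c ∈ S) (he : e ∈ S) :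
    (H.induce S).IsAlternatingFourCycle ⟨a, ha⟩ ⟨b, hb⟩ ⟨c, hc⟩ ⟨e, he⟩ := by
  obtain ⟨hab, hac, hae, hbc, hbe, hce, h1, h2, h3, h4⟩ := h
  constructor <;> simpa

theorem IsAlternatingFourCycle.of_induce {H : SimpleGraph V} {S : Set V} {a b c e : S}
    (h : (H.induce S).IsAlternatingFourCycle a b c e) :
    H.IsAlternatingFourCycle a b c e := by
  obtain ⟨hab, hac, hae, hbc, hbe, hce, h1, h2, h3, h4⟩ := h
  constructor <;> first | assumption | exact fun h => absurd (Subtype.ext h) (by assumption)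

/-- All four vertices of an alternating 4-cycle lie on one level, and pairs on different levels are
decided, hence the same in all realizations. -/
theorem twoSwitchRel_iff_of_level [Finite V] (lev : V → ι) (hw : G.IsThresholdWeight w)
    (hlev : ∀ x y, w x + w y = 0 → lev x = lev y) {H H' : SimpleGraph V}
    (hH : ∀ v, (H.neighborSet v).ncard = (G.neighborSet v).ncard)
    (hH' : ∀ v, (H'.neighborSet v).ncard = (G.neighborSet v).ncard) :
    TwoSwitchRel H H' ↔ ∃ i,
      TwoSwitchRel (H.induce {v | lev v = i}) (H'.induce {v | lev v = i}) ∧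
        ∀ j, j ≠ i → H.induce {v | lev v = j} = H'.induce {v | lev v = j} := by
  constructor
  · rintro ⟨a, b, c, e, h, rfl⟩
    have hl := (hw.of_ncard_eq hH).level h
    have hb : lev b = lev a := hlev _ _ (by omega)
    have hc : lev c = lev a := (hlev c b (by omega)).trans hb
    have he : lev e = lev a := hlev _ _ (by omega)
    have h' := h.induce (S := {v | lev v = lev a}) rfl hb hc he
    refine ⟨lev a, ⟨_, _, _, _, h', ?_⟩, ?_⟩
    · ext ⟨x, hx⟩ ⟨y, hy⟩
      rw [h'.twoSwitch_adj]
      simp only [comap_adj, Function.Embedding.subtype_apply, h.twoSwitch_adj, Sym2.eq_iff,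
        Subtype.mk.injEq, ne_eq]
    · intro j hj
      ext ⟨x, hx⟩ ⟨y, hy⟩
      have hx' : lev x = j := hx
      have hy' : lev y = j := hy
      simp only [comap_adj, Function.Embedding.subtype_apply, h.twoSwitch_adj, Sym2.eq_iff, ne_eq]
      have h1 : x ≠ a := by rintro rfl; exact hj hx'.symm
      have h2 : x ≠ b := by rintro rfl; exact hj (hx'.symm.trans hb)
      have h3 : x ≠ c := by rintro rfl; exact hj (hx'.symm.trans hc)
      have h4 : x ≠ e := by rintro rfl; exact hj (hx'.symm.trans he)
      simp [h1, h2, h3, h4]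
  · rintro ⟨i, ⟨a, b, c, e, h', heq⟩, hne⟩
    have h := h'.of_induce
    refine ⟨_, _, _, _, h, ?_⟩
    ext x y
    by_cases hxy : lev x = lev y
    · by_cases hx : lev x = i
      · have h1 : (H'.induce {v | lev v = i}).Adj ⟨x, hx⟩ ⟨y, hxy.symm.trans hx⟩ ↔
          ((H.induce {v | lev v = i}).twoSwitch a b c e).Adj ⟨x, hx⟩ ⟨y, hxy.symm.trans hx⟩ := by
          rw [heq]
        rw [h'.twoSwitch_adj] at h1
        rw [h.twoSwitch_adj]
        simpa only [comap_adj, Function.Embedding.subtype_apply, Sym2.eq_iff, Subtype.ext_iff,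
          ne_eq] using h1
      · have h1 : (H.induce {v | lev v = lev x}).Adj ⟨x, rfl⟩ ⟨y, hxy.symm⟩ ↔
          (H'.induce {v | lev v = lev x}).Adj ⟨x, rfl⟩ ⟨y, hxy.symm⟩ := by rw [hne _ hx]
        have ha : x ≠ a := by rintro rfl; exact hx a.2
        have hb : x ≠ b := by rintro rfl; exact hx b.2
        have hc : x ≠ c := by rintro rfl; exact hx c.2
        have he : x ≠ e := by rintro rfl; exact hx e.2
        rw [h.twoSwitch_adj]
        simp only [comap_adj, Function.Embedding.subtype_apply] at h1
        simp [ha, hb, hc, he, h1]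
    · have h0 : w x + w y ≠ 0 := fun h => hxy (hlev _ _ h)
      rw [hw.adj_iff_of_ncard_eq hH' h0, hw.adj_iff_of_ncard_eq
        (fun v => (h.ncard_neighborSet_twoSwitch v).trans (hH v)) h0]

/-- A threshold weight decomposes the realization graph as the Cartesian product of the realization
graphs of its levels. -/
theorem IsThresholdWeight.nonempty_iso_boxProdPi [Finite V] (lev : V → ι)
    (hw : G.IsThresholdWeight w) (hlev : ∀ x y, w x + w y = 0 → lev x = lev y) :
    Nonempty (degreeRealizationGraph (fun v => (G.neighborSet v).ncard) ≃g
      boxProdPi fun i => degreeRealizationGraph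
        (fun v => ((G.induce {v | lev v = i}).neighborSet v).ncard)) := by
  have hdiff : ∀ {H : SimpleGraph V}, (∀ x y, lev x ≠ lev y → (H.Adj x y ↔ G.Adj x y)) →
      ∀ v, H.neighborSet v \ {u | lev u = lev v} = G.neighborSet v \ {u | lev u = lev v} := by
    intro H hH v
    ext u
    simp only [Set.mem_sdiff, mem_neighborSet, Set.mem_ofPred_eq]
    exact and_congr_left fun h => hH v u (Ne.symm h)
  -- The degree toward other levels is the same in all realizations, so restricting to a level
  -- preserves degrees there; for the same reason, realizations of the levels glue to one of the
  -- whole.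
  have hsplit : ∀ (H : SimpleGraph V) v, (H.neighborSet v).ncard =
      ((H.induce {u | lev u = lev v}).neighborSet ⟨v, rfl⟩).ncard +
        (H.neighborSet v \ {u | lev u = lev v}).ncard := by
    intro H v
    rw [ncard_neighborSet_induce, Set.ncard_inter_add_ncard_sdiff_eq_ncard]
  let f : {H : SimpleGraph V // ∀ v, (H.neighborSet v).ncard = (G.neighborSet v).ncard} →
      ∀ i, {H : SimpleGraph {v | lev v = i} // ∀ v, (H.neighborSet v).ncard =
        ((G.induce {v | lev v = i}).neighborSet v).ncard} := fun H i =>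
    ⟨H.1.induce _, by
      rintro ⟨v, rfl⟩
      have h1 := hsplit H.1 v
      have h2 := hsplit G v
      rw [hdiff (fun x y h => hw.adj_iff_of_ncard_eq H.2 fun h' => h (hlev _ _ h')), H.2] at h1
      omega⟩
  have hf : Function.Bijective f := by
    constructor
    · rintro ⟨H, hH⟩ ⟨H', hH'⟩ heq
      ext x y
      change H.Adj x y ↔ H'.Adj x y
      by_cases hxy : lev x = lev y
      · have h1 : H.induce {v | lev v = lev x} = H'.induce {v | lev v = lev x} :=
          congrArg Subtype.val (congrFun heq (lev x))
        have h2 : (H.induce {v | lev v = lev x}).Adj ⟨x, rfl⟩ ⟨y, hxy.symm⟩ ↔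
          (H'.induce {v | lev v = lev x}).Adj ⟨x, rfl⟩ ⟨y, hxy.symm⟩ := by rw [h1]
        exact h2
      · have h0 : w x + w y ≠ 0 := fun h => hxy (hlev _ _ h)
        rw [hw.adj_iff_of_ncard_eq hH h0, hw.adj_iff_of_ncard_eq hH' h0]
    · intro K
      refine ⟨⟨G.glueLevels lev fun i => (K i).1, fun v => ?_⟩, ?_⟩
      · rw [hsplit, hsplit G, hdiff (fun x y h => glueLevels_adj_of_ne _ _ _ h), glueLevels_induce,
          (K (lev v)).2]
      · funext i
        exact Subtype.ext (glueLevels_induce _ _ _ i)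
  refine ⟨⟨Equiv.ofBijective f hf, ?_⟩⟩
  rintro ⟨H, hH⟩ ⟨H', hH'⟩
  change (∃ i, TwoSwitchRel (H.induce _) (H'.induce _) ∧
    ∀ j, j ≠ i → (f ⟨H, hH⟩) j = (f ⟨H', hH'⟩) j) ↔ TwoSwitchRel H H'
  rw [twoSwitchRel_iff_of_level lev hw hlev hH hH']
  simp only [f, Subtype.mk.injEq]

/-- Isomorphic factors give isomorphic Cartesian products. -/
def boxProdPiCongr {W W' : ι → Type*} {A : ∀ i, SimpleGraph (W i)} {B : ∀ i, SimpleGraph (W' i)}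
    (f : ∀ i, A i ≃g B i) : boxProdPi A ≃g boxProdPi B where
  toEquiv := Equiv.piCongrRight fun i => (f i).toEquiv
  map_rel_iff' {x y} := by
    change (∃ i, (B i).Adj (f i (x i)) (f i (y i)) ∧ ∀ j, j ≠ i → f j (x j) = f j (y j)) ↔
      ∃ i, (A i).Adj (x i) (y i) ∧ ∀ j, j ≠ i → x j = y j
    have h : ∀ i, (B i).Adj (f i (x i)) (f i (y i)) ↔ (A i).Adj (x i) (y i) := fun i =>
      (f i).map_adj_iff
    simp [h]

/-- The first factor of a Cartesian product can be split off. -/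
def boxProdPiSucc {m : ℕ} {W : Fin (m + 1) → Type*} (A : ∀ i, SimpleGraph (W i)) :
    boxProdPi A ≃g (boxProdPi fun i : Fin m => A i.succ) □ A 0 where
  toFun x := (fun i => x i.succ, x 0)
  invFun p := Fin.cons p.2 p.1
  left_inv x := Fin.cons_self_tail x
  right_inv p := by simp
  map_rel_iff' {x y} := by
    change ((∃ i : Fin m, (A i.succ).Adj (x i.succ) (y i.succ) ∧
      ∀ j, j ≠ i → x j.succ = y j.succ) ∧ x 0 = y 0 ∨
      (A 0).Adj (x 0) (y 0) ∧ (fun i : Fin m => x i.succ) = fun i : Fin m => y i.succ) ↔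
      ∃ i, (A i).Adj (x i) (y i) ∧ ∀ j, j ≠ i → x j = y j
    simp only [Fin.exists_fin_succ, Fin.forall_fin_succ, funext_iff]
    simp [Fin.succ_ne_zero, (Fin.succ_ne_zero _).symm, or_comm, and_comm,
      and_left_comm]

end Product

end SimpleGraph

/-! ### The twelve labelled 5-cycles -/

namespace SimpleGraph

/-- The adjacency matrices of the twelve 5-cycles on `Fin 5`: the bit `5 * i + j` tells whether `i`
and `j` are adjacent. -/
def fiveCycleCode : Fin 6 ⊕ Fin 6 → ℕ
  | .inl i => [10102962, 13190438, 6480426, 11046540, 3352340, 5360024][i]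
  | .inr i => [6407948, 3320472, 10030484, 5464370, 13158570, 11150886][i]

/-- The adjacency matrix of a 5-cycle on `Fin 5`. -/
def fiveCycleBit (s : Fin 6 ⊕ Fin 6) (i j : Fin 5) : Bool :=
  (fiveCycleCode s).testBit (5 * i + j)

theorem fiveCycleBit_symm : ∀ s i j, fiveCycleBit s i j = fiveCycleBit s j i := by
  decide +kernel

theorem fiveCycleBit_irrefl : ∀ s i, fiveCycleBit s i i = false := by
  decide +kernel

theorem fiveCycleBit_injective : ∀ s t, (∀ i j, fiveCycleBit s i j = fiveCycleBit t i j) →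
    s = t := by
  decide +kernel

theorem fiveCycleBit_regular : ∀ s i,
    (Finset.univ.filter fun j => fiveCycleBit s i j = true).card = 2 := by
  decide +kernel

set_option synthInstance.maxHeartbeats 400000 in
set_option synthInstance.maxSize 10000 in
-- Each degree condition stands as early as its variables allow, so that the exhaustive evaluation
-- discards most cases before later bits are tried.
theorem exists_fiveCycleBit_eq : ∀ b01 b02 b03 b04 : Bool,
    b01.toNat + b02.toNat + b03.toNat + b04.toNat = 2 → ∀ b12 b13 b14 : Bool,
    b01.toNat + b12.toNat + b13.toNat + b14.toNat = 2 → ∀ b23 b24 : Bool,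
    b02.toNat + b12.toNat + b23.toNat + b24.toNat = 2 → ∀ b34 : Bool,
    b03.toNat + b13.toNat + b23.toNat + b34.toNat = 2 →
    b04.toNat + b14.toNat + b24.toNat + b34.toNat = 2 →
    ∃ s, fiveCycleBit s 0 1 = b01 ∧ fiveCycleBit s 0 2 = b02 ∧ fiveCycleBit s 0 3 = b03 ∧
      fiveCycleBit s 0 4 = b04 ∧ fiveCycleBit s 1 2 = b12 ∧ fiveCycleBit s 1 3 = b13 ∧
      fiveCycleBit s 1 4 = b14 ∧ fiveCycleBit s 2 3 = b23 ∧ fiveCycleBit s 2 4 = b24 ∧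
      fiveCycleBit s 3 4 = b34 := by
  decide +kernel

/-- The bits of the result of a 2-switch. -/
def switchBit (b : Fin 5 → Fin 5 → Bool) (p q r s i j : Fin 5) : Bool :=
  (b i j && !(i == p && j == q || i == q && j == p) && !(i == r && j == s || i == s && j == r)) ||
    (i == p && j == s || i == s && j == p) || (i == q && j == r || i == r && j == q)

/-- The sides and indices of adjacent vertices of `K_{6,6} - 6K_2`. -/
def sixMinusMatchingAdj : Fin 6 ⊕ Fin 6 → Fin 6 ⊕ Fin 6 → Bool
  | .inl i, .inr j => i != j
  | .inr i, .inl j => i != j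
  | _, _ => false

set_option synthInstance.maxHeartbeats 400000 in
set_option synthInstance.maxSize 10000 in
theorem exists_switchBit_eq : ∀ s a b, fiveCycleBit s a b = true → ∀ c, fiveCycleBit s b c = false →
    b ≠ c → ∀ e, fiveCycleBit s c e = true → fiveCycleBit s a e = false → a ≠ e →
    ∃ t, sixMinusMatchingAdj s t = true ∧
      ∀ i j, fiveCycleBit t i j = switchBit (fiveCycleBit s) a b c e i j := by
  decide +kernel

set_option synthInstance.maxHeartbeats 400000 in
set_option synthInstance.maxSize 10000 in
theorem exists_switchBit_eq_of_adj : ∀ s t, sixMinusMatchingAdj s t = true →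
    ∃ a b, fiveCycleBit s a b = true ∧ ∃ c, fiveCycleBit s b c = false ∧
    b ≠ c ∧ ∃ e, fiveCycleBit s c e = true ∧ fiveCycleBit s a e = false ∧ a ≠ e ∧
      ∀ i j, fiveCycleBit t i j = switchBit (fiveCycleBit s) a b c e i j := by
  decide +kernel

end SimpleGraph

namespace SimpleGraph

/-- The twelve 5-cycles on `Fin 5`. -/
def fiveCycle (s : Fin 6 ⊕ Fin 6) : SimpleGraph (Fin 5) where
  Adj i j := fiveCycleBit s i j = true
  symm := ⟨fun i j h => (fiveCycleBit_symm s j i).trans h⟩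
  loopless := ⟨fun i h => by simp [fiveCycleBit_irrefl] at h⟩

theorem fiveCycle_adj {s : Fin 6 ⊕ Fin 6} {i j : Fin 5} :
    (fiveCycle s).Adj i j ↔ fiveCycleBit s i j = true := Iff.rfl

open Classical in
theorem ncard_neighborSet_eq_card_filter {V : Type*} [Fintype V] (H : SimpleGraph V) (v : V) :
    (H.neighborSet v).ncard = (Finset.univ.filter fun x => H.Adj v x).card := by
  rw [Set.ncard_eq_toFinset_card']
  congr 1
  ext x
  simp

theorem ncard_neighborSet_cycleGraph_five (v : Fin 5) :
    ((cycleGraph 5).neighborSet v).ncard = 2 := by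
  rw [ncard_neighborSet_eq_card_filter]
  have h : ∀ v, (Finset.univ.filter fun x => (cycleGraph 5).Adj v x).card = 2 := by decide
  convert h v

theorem ncard_neighborSet_fiveCycle (s : Fin 6 ⊕ Fin 6) (v : Fin 5) :
    ((fiveCycle s).neighborSet v).ncard = 2 := by
  rw [ncard_neighborSet_eq_card_filter, ← fiveCycleBit_regular s v]
  simp only [fiveCycle_adj]

theorem exists_eq_fiveCycle {H : SimpleGraph (Fin 5)} (hH : ∀ v, (H.neighborSet v).ncard = 2) :
    ∃ s, H = fiveCycle s := by
  classical
  let b : Fin 5 → Fin 5 → Bool := fun i j => decide (H.Adj i j)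
  have hb : ∀ i j, b i j = b j i := fun i j => by simp only [b, H.adj_comm]
  have hb0 : ∀ i, b i i = false := fun i => by simp [b]
  have hsum : ∀ i, (b i 0).toNat + (b i 1).toNat + (b i 2).toNat + (b i 3).toNat +
      (b i 4).toNat = 2 := by
    intro i
    rw [← hH i, ncard_neighborSet_eq_card_filter, Finset.card_filter, Fin.sum_univ_five]
    simp only [b, Bool.toNat, Bool.cond_decide]
  have h0 := hsum 0
  have h1 := hsum 1
  have h2 := hsum 2
  have h3 := hsum 3
  have h4 := hsum 4
  rw [hb0] at h0 h1 h2 h3 h4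
  rw [hb 1 0] at h1
  rw [hb 2 0, hb 2 1] at h2
  rw [hb 3 0, hb 3 1, hb 3 2] at h3
  rw [hb 4 0, hb 4 1, hb 4 2, hb 4 3] at h4
  simp only [Bool.toNat_false, zero_add, add_zero] at h0 h1 h2 h3 h4
  obtain ⟨s, e01, e02, e03, e04, e12, e13, e14, e23, e24, e34⟩ :=
    exists_fiveCycleBit_eq _ _ _ _ h0 _ _ _ h1 _ _ h2 _ h3 h4
  refine ⟨s, ?_⟩
  have hlt : ∀ i j, i < j → fiveCycleBit s i j = b i j := by
    intro i j hij
    fin_cases i <;> fin_cases j <;> first | exact absurd hij (by decide) | assumption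
  have hall : ∀ i j, fiveCycleBit s i j = b i j := by
    intro i j
    rcases lt_trichotomy i j with h | rfl | h
    · exact hlt i j h
    · rw [fiveCycleBit_irrefl, hb0]
    · rw [fiveCycleBit_symm, hb, hlt j i h]
  ext i j
  rw [fiveCycle_adj, hall]
  simp [b]

theorem completeBipartiteSixMinusMatching_adj {s t : Fin 6 ⊕ Fin 6} :
    completeBipartiteSixMinusMatching.Adj s t ↔ sixMinusMatchingAdj s t = true := by
  rcases s with i | i <;> rcases t with j | j <;>
    simp [completeBipartiteSixMinusMatching, sixMinusMatchingAdj] <;> exact not_congr eq_comm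

theorem twoSwitch_fiveCycle_adj {s : Fin 6 ⊕ Fin 6} {a b c e : Fin 5}
    (h : (fiveCycle s).IsAlternatingFourCycle a b c e) (i j : Fin 5) :
    ((fiveCycle s).twoSwitch a b c e).Adj i j ↔
      switchBit (fiveCycleBit s) a b c e i j = true := by
  rw [h.twoSwitch_adj, fiveCycle_adj]
  simp only [switchBit, Sym2.eq_iff, Bool.or_eq_true, Bool.and_eq_true, Bool.not_eq_true',
    beq_iff_eq, Bool.eq_false_iff, ne_eq, and_assoc, or_assoc]

/-- A 5-cycle has five 2-switches, one for each omitted vertex. They lead to the five cycles of the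
other side with a different index; the cycle with the same index is the complement. -/
theorem nonempty_iso_completeBipartiteSixMinusMatching :
    Nonempty (degreeRealizationGraph (fun v => ((cycleGraph 5).neighborSet v).ncard) ≃g
      completeBipartiteSixMinusMatching) := by
  let f : Fin 6 ⊕ Fin 6 → {H : SimpleGraph (Fin 5) // ∀ v, (H.neighborSet v).ncard =
      ((cycleGraph 5).neighborSet v).ncard} := fun s => ⟨fiveCycle s, fun v => by
    rw [ncard_neighborSet_fiveCycle, ncard_neighborSet_cycleGraph_five]⟩
  have hinj : Function.Injective f := by
    intro s t h
    have h' : fiveCycle s = fiveCycle t := congrArg Subtype.val h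
    apply fiveCycleBit_injective
    intro i j
    rw [Bool.eq_iff_iff, ← fiveCycle_adj, h', fiveCycle_adj]
  have hsurj : Function.Surjective f := by
    rintro ⟨H, hH⟩
    obtain ⟨s, rfl⟩ := exists_eq_fiveCycle
      fun v => (hH v).trans (ncard_neighborSet_cycleGraph_five v)
    exact ⟨s, rfl⟩
  refine ⟨RelIso.symm ⟨Equiv.ofBijective f ⟨hinj, hsurj⟩, ?_⟩⟩
  intro s t
  change TwoSwitchRel (fiveCycle s) (fiveCycle t) ↔ _
  rw [completeBipartiteSixMinusMatching_adj]
  constructor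
  · rintro ⟨a, b, c, e, h, heq⟩
    obtain ⟨t', ht', hbit⟩ := exists_switchBit_eq s a b h.adj_ab c
      (by simpa [fiveCycle_adj] using h.not_adj_bc) h.ne_bc e h.adj_ce
      (by simpa [fiveCycle_adj] using h.not_adj_ae) h.ne_ae
    have : t = t' := by
      apply fiveCycleBit_injective
      intro i j
      rw [hbit, Bool.eq_iff_iff, ← twoSwitch_fiveCycle_adj h, ← heq, fiveCycle_adj]
    rwa [this]
  · intro h
    obtain ⟨a, b, hab, c, hbc, hbc', e, hce, hae, hae', hbit⟩ := exists_switchBit_eq_of_adj s t h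
    have h' : (fiveCycle s).IsAlternatingFourCycle a b c e :=
      IsAlternatingFourCycle.of_adj hab hce (by simp [fiveCycle_adj, hae])
        (by simp [fiveCycle_adj, hbc]) hae' hbc'
    refine ⟨a, b, c, e, h', ?_⟩
    ext i j
    rw [twoSwitch_fiveCycle_adj h', ← hbit, fiveCycle_adj]

/-! ### The realization graph of a tame graph -/

/-- Isomorphic factors give isomorphic Cartesian products. -/
def boxProdCongr {α α' β β' : Type*} {A : SimpleGraph α} {A' : SimpleGraph α'}
    {B : SimpleGraph β} {B' : SimpleGraph β'} (f : A ≃g A') (g : B ≃g B') : boxProd A B ≃g boxProd A' B' where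
  toEquiv := Equiv.prodCongr f.toEquiv g.toEquiv
  map_rel_iff' {x y} := by
    change A'.Adj (f x.1) (f y.1) ∧ g x.2 = g y.2 ∨ B'.Adj (g x.2) (g y.2) ∧ f x.1 = f y.1 ↔
      A.Adj x.1 y.1 ∧ x.2 = y.2 ∨ B.Adj x.2 y.2 ∧ x.1 = y.1
    rw [f.map_adj_iff, g.map_adj_iff, f.injective.eq_iff, g.injective.eq_iff]

theorem IsSwitchTame.exists_iso_boxProdPi {V : Type*} [Finite V] {G : SimpleGraph V}
    (hG : G.IsSwitchTame) : ∃ (m : ℕ) (k : Fin m → ℕ), (∀ i, 1 ≤ k i) ∧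
      (Nonempty (degreeRealizationGraph (fun v => (G.neighborSet v).ncard) ≃g
          boxProdPi (fun i => transpositionGraph (k i))) ∨
        Nonempty (degreeRealizationGraph (fun v => (G.neighborSet v).ncard) ≃g
          boxProd (boxProdPi (fun i => transpositionGraph (k i)))
            completeBipartiteSixMinusMatching)) := by
  obtain ⟨w, hw⟩ := hG.exists_tightWeight
  obtain ⟨m, hm⟩ : ∃ m, ∀ v, (w v).natAbs ≤ m := by
    obtain ⟨m, hm⟩ := (Set.finite_range fun v => (w v).natAbs).bddAbove
    exact ⟨m, fun v => hm ⟨v, rfl⟩⟩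
  let lev : V → Fin (m + 1) := fun v => ⟨(w v).natAbs, Nat.lt_succ_of_le (hm v)⟩
  obtain ⟨f⟩ := hw.toIsThresholdWeight.nonempty_iso_boxProdPi lev fun x y h => by
    simp only [lev, Fin.mk.injEq]; omega
  have hmem : ∀ i v, v ∈ {v | lev v = i} ↔ (w v).natAbs = i := fun i v => by
    simp [lev, Fin.ext_iff]
  have htriv : ∀ i, (∀ x ∈ {v | lev v = i}, ∀ y ∈ {v | lev v = i}, x ≠ y → w x + w y ≠ 0) →
      Nonempty (degreeRealizationGraph
        (fun v => ((G.induce {v | lev v = i}).neighborSet v).ncard) ≃g transpositionGraph 1) :=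
    fun i h => (hw.toIsThresholdWeight.induce _).nonempty_iso_transpositionGraph_one
      fun x y hxy => h x x.2 y y.2 fun h' => hxy (Subtype.ext h')
  have hpos : ∀ i : Fin m, ∃ k, 1 ≤ k ∧ Nonempty (degreeRealizationGraph
      (fun v => ((G.induce {v | lev v = i.succ}).neighborSet v).ncard) ≃g
        transpositionGraph k) := by
    intro i
    rcases hw.level_pos hG (t := i + 1) (by omega) (hmem i.succ) with ⟨k, ε, hk, ⟨g⟩⟩ | h
    · obtain ⟨g'⟩ := nonempty_iso_transpositionGraph k ε
      exact ⟨k, hk, ⟨(degreeRealizationGraphIso g).trans g'⟩⟩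
    · exact ⟨1, le_rfl, htriv _ h⟩
  choose k hk hk' using hpos
  rcases hw.level_zero hG (S := {v | lev v = 0}) (fun v => by rw [hmem]; simp) with ⟨⟨g⟩⟩ | h
  · obtain ⟨g'⟩ := nonempty_iso_completeBipartiteSixMinusMatching
    exact ⟨m, k, hk, .inr ⟨f.trans ((boxProdPiSucc _).trans (boxProdCongr
      (boxProdPiCongr fun i => (hk' i).some) ((degreeRealizationGraphIso g).trans g')))⟩⟩
  -- Level 0 has no undecided pair here and contributes the trivial factor `T_1`.
  · refine ⟨m + 1, Fin.cons 1 k, ?_, .inl ⟨f.trans (boxProdPiCongr fun i => Nonempty.some ?_)⟩⟩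
    · exact Fin.cases le_rfl hk
    · induction i using Fin.cases with
      | zero => exact htriv 0 h
      | succ i => exact hk' i

end SimpleGraph

/-! ### Matroids from circuit elimination -/

/-- A finite clutter of nonempty sets with the weak elimination property is the set of circuits of
a matroid. -/
theorem Matroid.exists_isCircuit_iff {α : Type*} [Finite α] {𝒞 : Set (Set α)} (hempty : ∅ ∉ 𝒞)
    (hanti : ∀ C ∈ 𝒞, ∀ D ∈ 𝒞, C ⊆ D → C = D)
    (helim : ∀ C ∈ 𝒞, ∀ D ∈ 𝒞, C ≠ D → ∀ p ∈ C, p ∈ D → ∃ E ∈ 𝒞, E ⊆ (C ∪ D) \ {p}) :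
    ∃ M : Matroid α, M.E = Set.univ ∧ ∀ C, M.IsCircuit C ↔ C ∈ 𝒞 := by
  let Indep : Set α → Prop := fun I => ∀ C ∈ 𝒞, ¬ C ⊆ I
  have indep_subset : ∀ ⦃I J⦄, Indep J → I ⊆ J → Indep I := fun I J hJ hIJ C hC hCI =>
    hJ C hC (hCI.trans hIJ)
  have indep_aug : ∀ ⦃I J⦄, Indep I → Indep J → I.ncard < J.ncard →
      ∃ e ∈ J, e ∉ I ∧ Indep (insert e I) := by
    intro I J hI hJ hIJ
    by_contra! hcon
    -- `K` is as close to `I` as possible. Exchanging some `f ∈ K \ I` for `e ∈ I \ K` would come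
    -- closer, so it creates a circuit through `e` that avoids `f`.
    obtain ⟨K, ⟨hK, hKIJ, hIK⟩, hmin⟩ := Set.exists_min_image
      {K : Set α | Indep K ∧ K ⊆ I ∪ J ∧ I.ncard < K.ncard} (fun K => (I \ K).ncard)
      (Set.toFinite _) ⟨J, hJ, Set.subset_union_right, hIJ⟩
    have hne : ∃ e ∈ I, e ∉ K := by
      by_contra! h
      obtain ⟨f, hfK, hfI⟩ := Set.exists_mem_notMem_of_ncard_lt_ncard hIK
      refine hcon f ((hKIJ hfK).resolve_left hfI) hfI (indep_subset hK ?_)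
      exact Set.insert_subset hfK h
    obtain ⟨e, heI, heK⟩ := hne
    have hcirc : ∀ f ∈ K, f ∉ I → ∃ C ∈ 𝒞, C ⊆ insert e K ∧ f ∉ C ∧ e ∈ C := by
      intro f hfK hfI
      have h1 : ¬ Indep (insert e (K \ {f})) := by
        intro h
        have h2 := hmin (insert e (K \ {f})) ⟨h, ?_, ?_⟩
        · refine absurd h2 (not_le.2 (Set.ncard_lt_ncard ?_))
          refine ⟨fun x hx => ⟨hx.1, fun h' => hx.2 (.inr ⟨h', ?_⟩)⟩, fun h' => ?_⟩
          · rintro rfl; exact hfI hx.1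
          · exact (h' ⟨heI, heK⟩).2 (.inl rfl)
        · exact Set.insert_subset (.inl heI) (Set.sdiff_subset.trans hKIJ)
        · rwa [Set.ncard_exchange heK hfK]
      simp only [Indep, not_forall, not_not] at h1
      obtain ⟨C, hC, hCs⟩ := h1
      refine ⟨C, hC, hCs.trans (Set.insert_subset_insert Set.sdiff_subset), fun h => ?_, ?_⟩
      · rcases hCs h with rfl | h'
        · exact hfI heI
        · exact h'.2 rfl
      · by_contra he
        refine hK C hC fun x hx => ?_
        rcases hCs hx with rfl | h'
        · exact absurd hx he
        · exact h'.1
    obtain ⟨g, hgK, hgI⟩ := Set.exists_mem_notMem_of_ncard_lt_ncard hIK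
    obtain ⟨C, hC, hCs, -, heC⟩ := hcirc g hgK hgI
    obtain ⟨h, hhC, hhI⟩ := Set.not_subset.1 (hI C hC)
    have hhK : h ∈ K := (hCs hhC).resolve_left (by rintro rfl; exact hhI heI)
    -- `D` avoids the point `h` of `C`, so the two circuits differ, and eliminating their common
    -- point `e` leaves a circuit inside the independent set `K`.
    obtain ⟨D, hD, hDs, hhD, heD⟩ := hcirc h hhK hhI
    obtain ⟨E, hE, hEs⟩ := helim C hC D hD (by rintro rfl; exact hhD hhC) e heC heD
    refine hK E hE fun x hx => ?_
    obtain ⟨hx1, hx2⟩ := hEs hx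
    exact ((Set.union_subset hCs hDs) hx1).resolve_left hx2
  let M : Matroid α := (IndepMatroid.ofFinite (E := Set.univ) Set.finite_univ Indep
    (fun C hC h => hempty (Set.subset_empty_iff.1 h ▸ hC)) indep_subset indep_aug
    (fun _ _ => Set.subset_univ _)).matroid
  refine ⟨M, rfl, fun C => ?_⟩
  have hMI : ∀ I, M.Indep I ↔ Indep I := fun I => by simp [M]
  rw [Matroid.isCircuit_iff_minimal_not_indep (Set.subset_univ C)]
  simp only [hMI]
  constructor
  · rintro ⟨h1, h2⟩
    have h1' := h1
    simp only [Indep, not_forall, not_not] at h1'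
    obtain ⟨D, hD, hDC⟩ := h1'
    have h3 := h2 (y := D) (fun h => h D hD subset_rfl) hDC
    rwa [Set.Subset.antisymm h3 hDC]
  · intro hC
    refine ⟨fun h => h C hC subset_rfl, fun D hD hDC => ?_⟩
    simp only [Indep, not_forall, not_not] at hD
    obtain ⟨E, hE, hED⟩ := hD
    exact (hanti E hE C hC (hED.trans hDC)) ▸ hED

namespace SimpleGraph

/-! ### Pseudo-split and matrogenic graphs against tame graphs -/

section Circuits

variable {V W : Type*}

/-- `C` is the vertex set of an alternating 4-cycle. -/
def IsAlternatingSet (G : SimpleGraph V) (C : Set V) : Prop :=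
  ∃ a b c e : V, G.IsAlternatingFourCycle a b c e ∧ C = {a, b, c, e}

theorem IsAlternatingSet.ncard_eq {G : SimpleGraph V} {C : Set V} (h : G.IsAlternatingSet C) :
    C.ncard = 4 := by
  obtain ⟨a, b, c, e, ⟨hab, hac, hae, hbc, hbe, hce, -⟩, rfl⟩ := h
  rw [Set.ncard_eq_succ]
  refine ⟨a, {b, c, e}, by simp [hab, hac, hae], rfl, ?_⟩
  rw [Set.ncard_eq_three]
  exact ⟨b, c, e, hbc, hbe, hce, rfl⟩

/-- The vertex sets of alternating 4-cycles have the weak elimination property. -/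
def HasCircuitElimination (G : SimpleGraph V) : Prop :=
  ∀ C D, G.IsAlternatingSet C → G.IsAlternatingSet D → C ≠ D → ∀ p ∈ C, p ∈ D →
    ∃ E, G.IsAlternatingSet E ∧ E ⊆ (C ∪ D) \ {p}

theorem HasCircuitElimination.isMatrogenic [Finite V] {G : SimpleGraph V}
    (h : G.HasCircuitElimination) : G.IsMatrogenic := by
  obtain ⟨M, hM, hM'⟩ := Matroid.exists_isCircuit_iff (𝒞 := {C | G.IsAlternatingSet C})
    (fun h => by simpa using IsAlternatingSet.ncard_eq h)
    (fun C hC D hD hCD => Set.eq_of_subset_of_ncard_le hCD (by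
      rw [IsAlternatingSet.ncard_eq hC, IsAlternatingSet.ncard_eq hD]))
    (fun C hC D hD hne p hp hp' => h C D hC hD hne p hp hp')
  exact ⟨M, hM, hM'⟩

theorem IsAlternatingSet.image_iso {G : SimpleGraph V} {H : SimpleGraph W} (f : G ≃g H)
    {C : Set V} (h : G.IsAlternatingSet C) : H.IsAlternatingSet (f '' C) := by
  obtain ⟨a, b, c, e, h, rfl⟩ := h
  exact ⟨_, _, _, _, h.map_iso f, by simp [Set.image_insert_eq]⟩

theorem HasCircuitElimination.of_iso {G : SimpleGraph V} {H : SimpleGraph W} (f : G ≃g H)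
    (hH : H.HasCircuitElimination) : G.HasCircuitElimination := by
  intro C D hC hD hCD p hpC hpD
  obtain ⟨E, hE, hE'⟩ := hH _ _ (hC.image_iso f) (hD.image_iso f)
    (fun h => hCD (f.injective.image_injective h)) (f p) ⟨p, hpC, rfl⟩ ⟨p, hpD, rfl⟩
  refine ⟨f.symm '' E, hE.image_iso f.symm, ?_⟩
  rintro _ ⟨x, hx, rfl⟩
  obtain ⟨h1, h2⟩ := hE' hx
  rw [← Set.image_union] at h1
  obtain ⟨y, hy, rfl⟩ := h1
  have h3 : f.symm (f y) = y := f.symm_apply_apply y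
  rw [h3]
  exact ⟨hy, by rintro rfl; exact h2 rfl⟩

/-- Alternating 4-cycles with a common vertex lie on the same level. -/
theorem HasCircuitElimination.of_level {ι : Type*} {G : SimpleGraph V} {w : V → ℤ}
    (hw : G.IsThresholdWeight w) (lev : V → ι) (hlev : ∀ x y, w x + w y = 0 → lev x = lev y)
    (h : ∀ i, (G.induce {v | lev v = i}).HasCircuitElimination) : G.HasCircuitElimination := by
  have hres : ∀ C, G.IsAlternatingSet C → ∀ p ∈ C, ∃ C' : Set {v | lev v = lev p},
      (G.induce {v | lev v = lev p}).IsAlternatingSet C' ∧ C = Subtype.val '' C' := by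
    rintro C ⟨a, b, c, e, hC, rfl⟩ p hp
    have hl := hw.level hC
    have hb : lev b = lev a := hlev _ _ (by omega)
    have hc : lev c = lev a := (hlev c b (by omega)).trans hb
    have he : lev e = lev a := hlev _ _ (by omega)
    have hpa : lev a = lev p := by
      rcases hp with rfl | rfl | rfl | rfl
      exacts [rfl, hb.symm, hc.symm, he.symm]
    refine ⟨_, ⟨_, _, _, _, hC.induce (S := {v | lev v = lev p}) hpa (hb.trans hpa)
      (hc.trans hpa) (he.trans hpa), rfl⟩, ?_⟩
    simp [Set.image_insert_eq]
  intro C D hC hD hCD p hpC hpD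
  obtain ⟨C', hC', rfl⟩ := hres C hC p hpC
  obtain ⟨D', hD', rfl⟩ := hres D hD p hpD
  have hp : ∀ {A : Set {v | lev v = lev p}}, p ∈ Subtype.val '' A →
      (⟨p, rfl⟩ : {v | lev v = lev p}) ∈ A := by
    rintro A ⟨q, hqA, hq⟩
    obtain rfl : q = ⟨p, rfl⟩ := Subtype.ext hq
    exact hqA
  obtain ⟨E, ⟨a, b, c, e, hE, rfl⟩, hE'⟩ :=
    h (lev p) C' D' hC' hD' (fun h => hCD (by rw [h])) ⟨p, rfl⟩ (hp hpC) (hp hpD)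
  refine ⟨_, ⟨_, _, _, _, hE.of_induce, rfl⟩, ?_⟩
  have h1 := Set.image_mono (f := Subtype.val) hE'
  rw [Set.image_sdiff Subtype.val_injective, Set.image_union] at h1
  simpa [Set.image_insert_eq] using h1

theorem hasCircuitElimination_of_forall_ne {G : SimpleGraph V} {w : V → ℤ}
    (hw : G.IsThresholdWeight w) (h : ∀ x y, x ≠ y → w x + w y ≠ 0) :
    G.HasCircuitElimination := by
  rintro C D ⟨a, b, c, e, hC, rfl⟩
  have := hw.level hC
  exact absurd (by omega) (h a b hC.ne_ab)

theorem isAlternatingSet_permSplitGraph {α : Type*} {ε : Prop} {C : Set (α ⊕ α)} :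
    (permSplitGraph ε (1 : Equiv.Perm α)).IsAlternatingSet C ↔
      ∃ i j, i ≠ j ∧ C = {.inl i, .inr i, .inl j, .inr j} := by
  classical
  constructor
  · rintro ⟨a, b, c, e, h, rfl⟩
    obtain ⟨a', b', c', e', h', ha', heq⟩ : ∃ a' b' c' e' : α ⊕ α,
        (permSplitGraph ε (1 : Equiv.Perm α)).IsAlternatingFourCycle a' b' c' e' ∧
          0 ≤ splitWeight a' ∧ ({a, b, c, e} : Set (α ⊕ α)) = {a', b', c', e'} := by
      by_cases ha : 0 ≤ splitWeight a
      · exact ⟨a, b, c, e, h, ha, rfl⟩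
      · have := (isThresholdWeight_splitWeight ε 1).level h
        refine ⟨b, a, e, c, h.rotate, by omega, ?_⟩
        ext x; simp only [Set.mem_insert_iff, Set.mem_singleton_iff]; tauto
    obtain ⟨i, j, p, q, hij, rfl, rfl, rfl, rfl, h1, h2⟩ :=
      exists_of_isAlternatingFourCycle_permSplitGraph ha' h'
    refine ⟨i, j, hij, heq.trans ?_⟩
    by_cases hε : ε
    · obtain ⟨rfl, rfl⟩ := h1 hε
      rfl
    · obtain ⟨rfl, rfl⟩ := h2 hε
      ext x
      simp only [Set.mem_insert_iff, Set.mem_singleton_iff]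
      tauto
  · rintro ⟨i, j, hij, rfl⟩
    obtain ⟨p, q, h1, h2, h3, -⟩ := exists_twoSwitch_permSplitGraph ε 1 hij
    refine ⟨_, _, _, _, h3, ?_⟩
    by_cases hε : ε
    · obtain ⟨rfl, rfl⟩ := h1 hε
      rfl
    · obtain ⟨rfl, rfl⟩ := h2 hε
      ext x
      simp only [Set.mem_insert_iff, Set.mem_singleton_iff]
      tauto

/-- Alternating sets are unions of two matched pairs. Two of them that share the pair containing `p`
leave one further pair each, and these two pairs form the required set. -/
theorem hasCircuitElimination_permSplitGraph (α : Type*) (ε : Prop) :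
    (permSplitGraph ε (1 : Equiv.Perm α)).HasCircuitElimination := by
  intro C D hC hD hCD p hpC hpD
  rw [isAlternatingSet_permSplitGraph] at hC hD
  have hpick : ∀ C : Set (α ⊕ α), (∃ i j, i ≠ j ∧ C = {.inl i, .inr i, .inl j, .inr j}) →
      p ∈ C → ∃ j, j ≠ Sum.elim id id p ∧ C = {.inl (Sum.elim id id p), .inr (Sum.elim id id p),
        .inl j, .inr j} := by
    rintro C ⟨i, j, hij, rfl⟩ hp
    rcases hp with rfl | rfl | rfl | rfl
    · exact ⟨j, hij.symm, rfl⟩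
    · exact ⟨j, hij.symm, rfl⟩
    · refine ⟨i, hij, ?_⟩
      ext x; simp only [Set.mem_insert_iff, Set.mem_singleton_iff, Sum.elim_inl, id]; tauto
    · refine ⟨i, hij, ?_⟩
      ext x; simp only [Set.mem_insert_iff, Set.mem_singleton_iff, Sum.elim_inr, id]; tauto
  obtain ⟨i, hi, rfl⟩ := hpick C hC hpC
  obtain ⟨j, hj, rfl⟩ := hpick D hD hpD
  have hij : i ≠ j := by rintro rfl; exact hCD rfl
  refine ⟨_, isAlternatingSet_permSplitGraph.2 ⟨i, j, hij, rfl⟩, ?_⟩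
  rintro x (rfl | rfl | rfl | rfl) <;> refine ⟨by simp, ?_⟩ <;> rintro rfl <;> simp_all

theorem exists_compl_eq_of_ne : ∀ a b c e : Fin 5, a ≠ b → a ≠ c → a ≠ e → b ≠ c → b ≠ e →
    c ≠ e → ∃ x, ∀ y, y ≠ x ↔ y = a ∨ y = b ∨ y = c ∨ y = e := by
  decide +kernel

theorem exists_alternating_compl_cycleGraph_five : ∀ x : Fin 5, ∃ a b c e,
    (cycleGraph 5).Adj a b ∧ (cycleGraph 5).Adj c e ∧ ¬ (cycleGraph 5).Adj a e ∧
      ¬ (cycleGraph 5).Adj b c ∧ a ≠ e ∧ b ≠ c ∧ ∀ y, y ≠ x ↔ y = a ∨ y = b ∨ y = c ∨ y = e := by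
  decide +kernel

/-- The alternating sets are all the 4-element subsets, the circuits of the uniform matroid
`U_{3,5}`. Two different ones cover everything, so the complement of `p` works. -/
theorem hasCircuitElimination_cycleGraph_five : (cycleGraph 5).HasCircuitElimination := by
  have hcompl : ∀ C, (cycleGraph 5).IsAlternatingSet C → ∃ x, C = {x}ᶜ := by
    rintro C ⟨a, b, c, e, ⟨hab, hac, hae, hbc, hbe, hce, -⟩, rfl⟩
    obtain ⟨x, hx⟩ := exists_compl_eq_of_ne a b c e hab hac hae hbc hbe hce
    exact ⟨x, Set.ext fun y => (hx y).symm⟩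
  intro C D hC hD hCD p hpC hpD
  obtain ⟨x, rfl⟩ := hcompl C hC
  obtain ⟨y, rfl⟩ := hcompl D hD
  obtain ⟨a, b, c, e, h1, h2, h3, h4, h5, h6, h7⟩ := exists_alternating_compl_cycleGraph_five p
  refine ⟨_, ⟨a, b, c, e, IsAlternatingFourCycle.of_adj h1 h2 h3 h4 h5 h6, rfl⟩, ?_⟩
  intro z hz
  refine ⟨?_, (h7 z).2 hz⟩
  by_contra hcon
  simp only [Set.mem_union, Set.mem_compl_iff, Set.mem_singleton_iff, not_or, not_not] at hcon
  exact hCD (by rw [← hcon.1, ← hcon.2])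

theorem IsSwitchTame.isMatrogenic [Finite V] {G : SimpleGraph V} (hG : G.IsSwitchTame) :
    G.IsMatrogenic := by
  obtain ⟨w, hw⟩ := hG.exists_tightWeight
  apply HasCircuitElimination.isMatrogenic
  apply HasCircuitElimination.of_level hw.toIsThresholdWeight (fun v => (w v).natAbs)
    (fun x y h => by omega)
  have htriv : ∀ t, (∀ x ∈ {v | (w v).natAbs = t}, ∀ y ∈ {v | (w v).natAbs = t}, x ≠ y →
      w x + w y ≠ 0) → (G.induce {v | (w v).natAbs = t}).HasCircuitElimination := fun t h =>
    hasCircuitElimination_of_forall_ne (hw.toIsThresholdWeight.induce _)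
      fun x y hxy => h x x.2 y y.2 fun h' => hxy (Subtype.ext h')
  intro t
  by_cases ht : t = 0
  · subst ht
    rcases hw.level_zero hG (S := {v | (w v).natAbs = 0}) (fun v => by simp) with ⟨⟨f⟩⟩ | h
    · exact hasCircuitElimination_cycleGraph_five.of_iso f
    · exact htriv _ h
  · rcases hw.level_pos hG (S := {v | (w v).natAbs = t}) ht (fun v => by simp) with
      ⟨k, ε, -, ⟨f⟩⟩ | h
    · exact (hasCircuitElimination_permSplitGraph _ ε).of_iso f
    · exact htriv _ h

theorem IsSwitchTame.isPseudoSplit [Finite V] {G : SimpleGraph V} (hG : G.IsSwitchTame) :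
    G.IsPseudoSplit := by
  obtain ⟨w, hw⟩ := hG.exists_tightWeight
  rcases hw.level_zero hG (S := {v | w v = 0}) (fun v => by simp) with ⟨⟨f⟩⟩ | h
  · refine ⟨{v | w v < 0}, {v | 0 < w v}, {v | w v = 0}, ?_, ?_, ?_, ?_, ?_, ?_, ?_, ?_,
      .inr ⟨f⟩⟩
    · rw [Set.disjoint_left]; intro v h1 h2; simp only [Set.mem_ofPred_eq] at h1 h2; omega
    · rw [Set.disjoint_left]; intro v h1 h2; simp only [Set.mem_ofPred_eq] at h1 h2; omega
    · rw [Set.disjoint_left]; intro v h1 h2; simp only [Set.mem_ofPred_eq] at h1 h2; omega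
    · ext v; simp only [Set.mem_union, Set.mem_ofPred_eq, Set.mem_univ, iff_true]; omega
    · intro x hx y hy _; exact hw.not_adj (add_neg hx hy)
    · intro x hx y hy hxy; exact hw.adj hxy (add_pos hx hy)
    · intro x hx y hy; exact hw.not_adj (by simp only [Set.mem_ofPred_eq] at hx hy; omega)
    · intro x hx y hy
      simp only [Set.mem_ofPred_eq] at hx hy
      exact hw.adj (by rintro rfl; omega) (by omega)
  -- At most one vertex has weight 0, and it may join the independent set.
  · refine ⟨{v | w v ≤ 0}, {v | 0 < w v}, ∅, ?_, by simp, by simp, ?_, ?_, ?_, by simp, by simp,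
      .inl rfl⟩
    · rw [Set.disjoint_left]; intro v h1 h2; simp only [Set.mem_ofPred_eq] at h1 h2; omega
    · ext v
      simp only [Set.union_empty, Set.mem_union, Set.mem_ofPred_eq, Set.mem_univ, iff_true]; omega
    · intro x hx y hy hxy
      simp only [Set.mem_ofPred_eq] at hx hy
      have h0 : w x + w y ≠ 0 := fun h0 =>
        h x (show w x = 0 by omega) y (show w y = 0 by omega) hxy h0
      exact hw.not_adj (by omega)
    · intro x hx y hy hxy; exact hw.adj hxy (add_pos hx hy)

theorem IsAlternatingFourCycle.exists_mem {G : SimpleGraph V} {a b c e p : V}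
    (h : G.IsAlternatingFourCycle a b c e) (hp : p ∈ ({a, b, c, e} : Set V)) :
    (∃ q ∈ ({a, b, c, e} : Set V), G.Adj p q) ∧
      ∃ q ∈ ({a, b, c, e} : Set V), q ≠ p ∧ ¬ G.Adj p q := by
  rcases hp with rfl | rfl | rfl | rfl
  · exact ⟨⟨b, by simp, h.adj_ab⟩, e, by simp, h.ne_ae.symm, h.not_adj_ae⟩
  · exact ⟨⟨a, by simp, h.adj_ab.symm⟩, c, by simp, h.ne_bc.symm, h.not_adj_bc⟩
  · exact ⟨⟨e, by simp, h.adj_ce⟩, b, by simp, h.ne_bc, fun h' => h.not_adj_bc h'.symm⟩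
  · exact ⟨⟨c, by simp, h.adj_ce.symm⟩, a, by simp, h.ne_ae, fun h' => h.not_adj_ae h'.symm⟩

theorem cycleGraph_five_diagonal : ∀ a b c e, (cycleGraph 5).Adj a b → (cycleGraph 5).Adj c e →
    ¬ (cycleGraph 5).Adj a e → ¬ (cycleGraph 5).Adj b c → a ≠ e → b ≠ c →
    ((cycleGraph 5).Adj a c ↔ ¬ (cycleGraph 5).Adj b e) := by
  decide +kernel

/-- Weights -1, 1, 0 on `V₁`, `V₂`, `V₃` form a threshold weight. So an alternating 4-cycle either
has one diagonal in the clique and the other in the independent set, or lies inside the 5-cycle. -/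
theorem IsPseudoSplit.diagonal {G : SimpleGraph V} (hG : G.IsPseudoSplit) {a b c e : V}
    (h : G.IsAlternatingFourCycle a b c e) : G.Adj a c ↔ ¬ G.Adj b e := by
  classical
  obtain ⟨V₁, V₂, V₃, h12, h13, h23, huniv, hind, hcl, hn, ha, h3⟩ := hG
  let w : V → ℤ := fun v => if v ∈ V₂ then 1 else if v ∈ V₁ then -1 else 0
  have hw2 : ∀ v, v ∈ V₂ ↔ w v = 1 := fun v => by
    simp only [w]; split_ifs <;> simp_all
  have hw1 : ∀ v, v ∈ V₁ ↔ w v = -1 := fun v => by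
    have : v ∈ V₁ → v ∉ V₂ := fun h => Set.disjoint_left.1 h12 h
    simp only [w]; split_ifs <;> simp_all
  have hcases : ∀ v, v ∈ V₁ ∨ v ∈ V₂ ∨ v ∈ V₃ := fun v => by
    have h : v ∈ V₁ ∪ V₂ ∪ V₃ := huniv ▸ Set.mem_univ v
    simpa [or_assoc] using h
  have hw3 : ∀ v, v ∈ V₃ ↔ w v = 0 := fun v => by
    have h1 : v ∈ V₁ → v ∉ V₃ := fun h => Set.disjoint_left.1 h13 h
    have h2 : v ∈ V₂ → v ∉ V₃ := fun h => Set.disjoint_left.1 h23 h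
    have h4 := hcases v
    clear hw1 hw2 hcases hn ha
    simp only [w]; split_ifs <;> simp_all
  have hw : G.IsThresholdWeight w := by
    constructor
    · intro x y hxy h
      rcases hcases x with hx | hx | hx <;> rcases hcases y with hy | hy | hy <;>
        first
        | exact hcl hx hy hxy
        | exact ha x hx y hy
        | exact (ha y hy x hx).symm
        | (simp only [hw1, hw2, hw3] at hx hy; omega)
    · intro x y h hadj
      rcases hcases x with hx | hx | hx <;> rcases hcases y with hy | hy | hy <;>
        first
        | exact hind hx hy hadj.ne hadj
        | exact hn x hx y hy hadj
        | exact hn y hy x hx hadj.symm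
        | (simp only [hw1, hw2, hw3] at hx hy; omega)
  obtain ⟨hb, hc, he⟩ := hw.level h
  rcases hcases a with hx | hx | hx
  · have hc' : c ∈ V₁ := by rw [hw1] at hx ⊢; omega
    have hb' : b ∈ V₂ := by rw [hw1] at hx; rw [hw2]; omega
    have he' : e ∈ V₂ := by rw [hw1] at hx; rw [hw2]; omega
    exact iff_of_false (hind hx hc' h.ne_ac) (not_not.2 (hcl hb' he' h.ne_be))
  · have hc' : c ∈ V₂ := by rw [hw2] at hx ⊢; omega
    have hb' : b ∈ V₁ := by rw [hw2] at hx; rw [hw1]; omega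
    have he' : e ∈ V₁ := by rw [hw2] at hx; rw [hw1]; omega
    exact iff_of_true (hcl hx hc' h.ne_ac) (hind hb' he' h.ne_be)
  · rcases h3 with rfl | ⟨⟨f⟩⟩
    · simp at hx
    have h' := (h.induce hx (show b ∈ V₃ by rw [hw3] at hx ⊢; omega)
      (show c ∈ V₃ by rw [hw3] at hx ⊢; omega) (show e ∈ V₃ by rw [hw3] at hx ⊢; omega)).map_iso f
    have h5 := cycleGraph_five_diagonal _ _ _ _ h'.adj_ab h'.adj_ce h'.not_adj_ae h'.not_adj_bc
      h'.ne_ae h'.ne_bc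
    rw [f.map_adj_iff, f.map_adj_iff] at h5
    exact h5

/-- If `y ≠ z`, eliminating `x` from the circuits `{u, x, v, y}` and `{u, x, v, z}` makes `{u, v, y,
z}` a circuit. Every vertex of an alternating 4-cycle has a neighbor and a non-neighbor in it, so
`v` must miss `u` while `u` must be adjacent to `v`. -/
theorem IsMatrogenic.private_unique {G : SimpleGraph V} (hG : G.IsMatrogenic) {u v x y z : V}
    (hux : G.Adj u x) (hvx : ¬ G.Adj v x) (hxv : x ≠ v) (hvy : G.Adj v y) (huy : ¬ G.Adj u y)
    (hyu : y ≠ u) (hvz : G.Adj v z) (huz : ¬ G.Adj u z) (hzu : z ≠ u) : y = z := by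
  obtain ⟨M, -, hM⟩ := hG
  by_contra hyz
  have h1 := IsAlternatingFourCycle.of_adj hux hvy huy (fun h => hvx h.symm) hyu.symm hxv
  have h2 := IsAlternatingFourCycle.of_adj hux hvz huz (fun h => hvx h.symm) hzu.symm hxv
  have hne : ({u, x, v, y} : Set V) ≠ {u, x, v, z} := by
    intro h
    have : y ∈ ({u, x, v, z} : Set V) := h ▸ by simp
    rcases this with h | h | h | h
    exacts [hyu h, h1.ne_be h.symm, hvy.ne h.symm, hyz h]
  obtain ⟨C, hCs, hC⟩ := ((hM _).2 ⟨_, _, _, _, h1, rfl⟩).elimination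
    ((hM _).2 ⟨_, _, _, _, h2, rfl⟩) hne x
  have hC' := (hM C).1 hC
  have hsub : C ⊆ {u, v, y, z} := by
    intro p hp
    obtain ⟨h3, h4⟩ := hCs hp
    simp only [Set.mem_union, Set.mem_insert_iff, Set.mem_singleton_iff] at h3 h4 ⊢
    tauto
  have hcard : ({u, v, y, z} : Set V).ncard ≤ C.ncard := by
    have h4 : C.ncard = 4 := IsAlternatingSet.ncard_eq hC'
    rw [h4]
    refine (Set.ncard_insert_le _ _).trans (Nat.succ_le_succ ?_)
    refine (Set.ncard_insert_le _ _).trans (Nat.succ_le_succ ?_)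
    exact (Set.ncard_insert_le _ _).trans (by simp)
  have hCeq := Set.eq_of_subset_of_ncard_le hsub hcard
  obtain ⟨a, b, c, e, h, hC''⟩ := hC'
  rw [hCeq] at hC''
  obtain ⟨-, q, hq, hqv, hvq⟩ := h.exists_mem (p := v) (hC'' ▸ by simp)
  obtain ⟨⟨r, hr, hur⟩, -⟩ := h.exists_mem (p := u) (hC'' ▸ by simp)
  rw [← hC''] at hq hr
  have hvu : ¬ G.Adj v u := by
    rcases hq with rfl | rfl | rfl | rfl
    exacts [hvq, absurd rfl hqv, absurd hvy hvq, absurd hvz hvq]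
  rcases hr with rfl | rfl | rfl | rfl
  exacts [hur.ne rfl, hvu hur.symm, huy hur, huz hur]

end Circuits

/-! ### Bipartiteness of the factors and of their products -/

section Coloring

/-- A coloring with the two signs. -/
def IsSignColorable {V : Type*} (G : SimpleGraph V) : Prop :=
  ∃ c : V → ℤˣ, ∀ x y, G.Adj x y → c x ≠ c y

theorem IsSignColorable.isBipartite {V : Type*} {G : SimpleGraph V} (h : G.IsSignColorable) :
    G.IsBipartite := by
  obtain ⟨c, hc⟩ := h
  have := (Coloring.mk c fun {x y} h => hc x y h).colorable
  simpa using this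

theorem IsSignColorable.of_iso {V W : Type*} {G : SimpleGraph V} {H : SimpleGraph W}
    (h : H.IsSignColorable) (f : G ≃g H) : G.IsSignColorable := by
  obtain ⟨c, hc⟩ := h
  exact ⟨c ∘ f, fun x y h => hc _ _ (f.map_adj_iff.2 h)⟩

theorem isSignColorable_transpositionGraph (k : ℕ) : (transpositionGraph k).IsSignColorable := by
  refine ⟨fun σ => Equiv.Perm.sign σ, ?_⟩
  intro σ τ h heq
  simp only at heq
  have h1 := Equiv.Perm.IsSwap.sign_eq h
  rw [Equiv.Perm.sign_mul, Equiv.Perm.sign_inv, heq, Int.units_mul_self] at h1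
  exact absurd h1 (by decide)

/-- An edge changes exactly one factor of the product of the colors. Colors in a group allow the
remaining factors to be cancelled. -/
theorem IsSignColorable.boxProdPi {ι : Type*} [Fintype ι] {W : ι → Type*}
    {A : ∀ i, SimpleGraph (W i)} (h : ∀ i, (A i).IsSignColorable) :
    (boxProdPi A).IsSignColorable := by
  classical
  choose c hc using h
  refine ⟨fun x => ∏ i, c i (x i), ?_⟩
  rintro x y ⟨i, hi, hne⟩ heq
  simp only at heq
  rw [Fintype.prod_eq_mul_prod_compl i, Fintype.prod_eq_mul_prod_compl i] at heq
  have h1 : ∏ j ∈ {i}ᶜ, c j (x j) = ∏ j ∈ {i}ᶜ, c j (y j) :=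
    Finset.prod_congr rfl fun j hj => by rw [hne j (by simpa using hj)]
  rw [h1] at heq
  exact hc i _ _ hi (mul_right_cancel heq)

theorem IsSignColorable.boxProd {V W : Type*} {G : SimpleGraph V} {H : SimpleGraph W}
    (hG : G.IsSignColorable) (hH : H.IsSignColorable) : (G □ H).IsSignColorable := by
  obtain ⟨c, hc⟩ := hG
  obtain ⟨c', hc'⟩ := hH
  refine ⟨fun p => c p.1 * c' p.2, ?_⟩
  rintro ⟨x, x'⟩ ⟨y, y'⟩ h heq
  rw [boxProd_adj] at h
  rcases h with ⟨h1, h2⟩ | ⟨h1, h2⟩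
  · simp only at h1 h2 heq
    rw [h2] at heq
    exact hc _ _ h1 (mul_right_cancel heq)
  · simp only at h1 h2 heq
    rw [h2] at heq
    exact hc' _ _ h1 (mul_left_cancel heq)

theorem isSignColorable_completeBipartiteSixMinusMatching :
    completeBipartiteSixMinusMatching.IsSignColorable := by
  refine ⟨Sum.elim (fun _ => 1) (fun _ => -1), ?_⟩
  rintro (i | i) (j | j) h <;> simp_all [completeBipartiteSixMinusMatching]

end Coloring

end SimpleGraph

/-! ### The equivalence -/

theorem mainTheorem1 {n : ℕ} (hn : 0 < n) (d : Fin n → ℕ) (hanti : Antitone d)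
    (hd : ∃ G : SimpleGraph (Fin n), SimpleGraph.IsRealization d G) :
    List.TFAE [
      (SimpleGraph.realizationGraph d).IsBipartite,
      (SimpleGraph.realizationGraph d).CliqueFree 3,
      ∃ (m : ℕ) (k : Fin m → ℕ), (∀ i, 1 ≤ k i) ∧
        (Nonempty (SimpleGraph.realizationGraph d ≃g
            SimpleGraph.boxProdPi (fun i => SimpleGraph.transpositionGraph (k i))) ∨
          Nonempty (SimpleGraph.realizationGraph d ≃g
            SimpleGraph.boxProd
              (SimpleGraph.boxProdPi (fun i => SimpleGraph.transpositionGraph (k i)))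
              SimpleGraph.completeBipartiteSixMinusMatching)),
      ∃ G : SimpleGraph (Fin n),
        SimpleGraph.IsRealization d G ∧ G.IsPseudoSplit ∧ G.IsMatrogenic] := by
  have tame_of_isMatrogenic : ∀ G : SimpleGraph (Fin n), G.IsPseudoSplit → G.IsMatrogenic →
      G.IsSwitchTame := fun G h h' =>
    ⟨fun _ _ _ _ _ h1 h2 h3 h4 h5 h6 h7 h8 h9 => h'.private_unique h1 h2 h3 h4 h5 h6 h7 h8 h9,
      fun _ _ _ _ h'' => h.diagonal h''⟩
  tfae_have 1 → 2 := fun h => h.cliqueFree (by norm_num)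
  tfae_have 2 → 4 := by
    intro h
    obtain ⟨G, hG⟩ := hd
    have hT : G.IsSwitchTame := SimpleGraph.isSwitchTame_of_cliqueFree (d := d) h hG
    exact ⟨G, hG, hT.isPseudoSplit, hT.isMatrogenic⟩
  tfae_have 4 → 3 := by
    rintro ⟨G, hG, hps, hm⟩
    obtain rfl : (fun v => (G.neighborSet v).ncard) = d := funext hG
    exact (tame_of_isMatrogenic G hps hm).exists_iso_boxProdPi
  tfae_have 3 → 1 := by
    rintro ⟨m, k, -, ⟨⟨f⟩⟩ | ⟨⟨f⟩⟩⟩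
    · exact ((SimpleGraph.IsSignColorable.boxProdPi fun i =>
        SimpleGraph.isSignColorable_transpositionGraph (k i)).of_iso f).isBipartite
    · exact (((SimpleGraph.IsSignColorable.boxProdPi fun i =>
        SimpleGraph.isSignColorable_transpositionGraph (k i)).boxProd
          SimpleGraph.isSignColorable_completeBipartiteSixMinusMatching).of_iso f).isBipartite
  tfae_finish
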